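/- Let $M$ be a connected complex manifold of complex dimension $n$ with complex structure $J$, let $T$ be a real torus acting smoothly on $M$ by biholomorphisms, and let $X$ be a real holomorphic vector field on $M$ such that $JX$ lies in the Lie algebra of $T$. Let $D$ be a compact connected complex manifold with a Kähler form $\omega_D$ whose Ricci form satisfies $\rho_{\omega_D}=\omega_D$. Let $\omega$ be (the Kähler form of) a complete $T$-invariant Kähler metric on $M$ for which there are compact sets $K\subset M$ and $\widehat K\subset\mathbb{C}\times D$ with $\{0\}\times D\subset\widehat K$, a biholomorphism $\nu:M\setminus K\to(\mathbb{C}\times D)\setminus\widehat K$ and a number $\lambda>0$ such that, with $z$ the coordinate on $\mathbb{C}$, 1. $d\nu(X)=\frac{2}{\lambda}\operatorname{Re}(z\partial_z)$; 2. $\omega=\nu^*\left(\frac{i}{2}\partial\bar\partial|z|^{2\lambda}+\omega_D\right)$ on $M\setminus K$; 3. $\rho_\omega+\frac12\mathcal{L}_X\omega-\omega=i\partial\bar\partial F_1$ for some compactly supported $F_1\in C^\infty(M)$ with $\mathcal{L}_{JX}F_1=0$. Then there exists $\tilde\varphi\in C^\infty(M)$ with $\mathcal{L}_{JX}\tilde\varphi=0$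 and $\omega_{\tilde\varphi}:=\omega+i\partial\bar\partial\tilde\varphi>0$ such that $$\rho_{\omega_{\tilde\varphi}}+\tfrac12\mathcal{L}_X\omega_{\tilde\varphi}=\omega_{\tilde\varphi}$$ if and only if for all $a\in\mathbb{R}$ there exist $\varphi\in C^\infty(M)$ with $\mathcal{L}_{JX}\varphi=0$ and $\omega+i\partial\bar\partial\varphi>0$, and a compactly supported $F_2\in C^\infty(M)$ with $\mathcal{L}_{JX}F_2=0$ and $$\rho_\omega+\tfrac12\mathcal{L}_X\omega-\omega=i\partial\bar\partial F_2,$$ such that $$\log\left(\frac{(\omega+i\partial\bar\partial\varphi)^n}{\omega^n}\right)-\frac{X}{2}\cdot\varphi+\varphi=F_2+a.$$ Here $\rho$ denotes the Ricci form, and all functions are real-valued. -/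

import Mathlib

open scoped Manifold ContDiff Topology

noncomputable section

namespace KRSoliton

/-! Complex manifolds are charted spaces over a finite-dimensional complex vector space `E` with
analytic complex transition maps. The underlying real manifold has the same charts and the model
`𝓘(ℝ, E)`. As everywhere in Mathlib, the tangent space at `p` is `E`, read in the preferred chart
`chartAt E p`; since the charts are holomorphic, the complex structure `J` on it is multiplication
by `Complex.I`. -/

section Flat

variable (E : Type*) [NormedAddCommGroup E] [NormedSpace ℂ E]

/-- Multiplication by `i`, as a real linear map. -/
def mulI : E →L[ℝ] E :=
  (Complex.I • ContinuousLinearMap.id ℂ E).restrictScalars ℝ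

/-- The real frame `b₁, i b₁, b₂, i b₂, …` belonging to a complex basis `b` of `E`: the coordinate
vector fields `∂/∂x₁, ∂/∂y₁, ∂/∂x₂, ∂/∂y₂, …` of the linear coordinates `zⱼ = xⱼ + i yⱼ` dual
to `b`. -/
def frame [FiniteDimensional ℂ E] : Fin (Module.finrank ℂ E) × Fin 2 → E :=
  fun j => if j.2 = 0 then Module.finBasis ℂ E j.1 else Complex.I • Module.finBasis ℂ E j.1

variable {E}

/-- `i∂∂̄f` on an open subset of `E`. With `B` the real Hessian of `f`, this is the real 2-form
`(u, v) ↦ (B(iu, v) - B(u, iv)) / 2`, which in linear coordinates is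
`i ∑ ∂²f/∂zⱼ∂z̄ₖ dzⱼ ∧ dz̄ₖ`. -/
def ddbarFlat (f : E → ℝ) (x : E) : E →L[ℝ] E →L[ℝ] ℝ :=
  (1 / 2 : ℝ) •
    ((fderiv ℝ (fderiv ℝ f) x).bilinearComp (mulI E) (ContinuousLinearMap.id ℝ E) -
      (fderiv ℝ (fderiv ℝ f) x).bilinearComp (ContinuousLinearMap.id ℝ E) (mulI E))

/-- The Lie derivative of a 2-form `W` along a vector field `V` on an open subset of `E`:
`(L_V W)(u, v) = (V · W)(u, v) + W(DV u, v) + W(u, DV v)`. -/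
def lieFlat (V : E → E) (W : E → E →L[ℝ] E →L[ℝ] ℝ) (x : E) : E →L[ℝ] E →L[ℝ] ℝ :=
  fderiv ℝ W x (V x) +
    (W x).bilinearComp (fderiv ℝ V x) (ContinuousLinearMap.id ℝ E) +
    (W x).bilinearComp (ContinuousLinearMap.id ℝ E) (fderiv ℝ V x)

/-- The `k`-fold wedge power `α ∧ … ∧ α` of a 2-form, evaluated on `2k` vectors. -/
def wedgePow (α : E →L[ℝ] E →L[ℝ] ℝ) (k : ℕ) (v : Fin k × Fin 2 → E) : ℝ :=
  (1 / 2 : ℝ) ^ k * ∑ σ : Equiv.Perm (Fin k × Fin 2),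
    ((Equiv.Perm.sign σ : ℤ) : ℝ) * ∏ i : Fin k, α (v (σ (i, 0))) (v (σ (i, 1)))

/-- The coefficient of the top power `αⁿ` with respect to `dx₁ ∧ dy₁ ∧ … ∧ dxₙ ∧ dyₙ`. -/
def topCoeff [FiniteDimensional ℂ E] (α : E →L[ℝ] E →L[ℝ] ℝ) : ℝ :=
  wedgePow α (Module.finrank ℂ E) (frame E)

end Flat

section Manifold

variable (E : Type*) [NormedAddCommGroup E] [NormedSpace ℂ E]
  (M : Type*) [TopologicalSpace M]

/-- Real vector fields on `M`; the value at `p` lies in `T_pM = E`. -/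
abbrev VectorField := M → E

/-- Fields of real bilinear forms on the tangent spaces `T_pM = E`. -/
abbrev TwoForm := M → E →L[ℝ] E →L[ℝ] ℝ

variable {E M} [ChartedSpace E M]

/-- The vector field `JX`. -/
def rotate (X : VectorField E M) : VectorField E M := fun p => Complex.I • X p

/-- The derivative `X · f = L_X f` of a function along a vector field. -/
def dirDeriv (X : VectorField E M) (f : M → ℝ) (p : M) : ℝ :=
  mfderiv 𝓘(ℝ, E) 𝓘(ℝ, ℝ) f p (X p)

/-- Smooth real-valued functions on `M`. -/
def IsSmooth (E : Type*) [NormedAddCommGroup E] [NormedSpace ℂ E] {M : Type*} [TopologicalSpace M]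
    [ChartedSpace E M] (f : M → ℝ) : Prop :=
  ContMDiff 𝓘(ℝ, E) 𝓘(ℝ, ℝ) ∞ f

/-- The expression of a vector field in a chart. -/
def chartField (e : OpenPartialHomeomorph M E) (X : VectorField E M) (x : E) : E :=
  mfderiv 𝓘(ℝ, E) 𝓘(ℝ, E) e (e.symm x) (X (e.symm x))

/-- The expression of a 2-form in a chart, that is, its pullback by the inverse of the chart. -/
def chartForm (e : OpenPartialHomeomorph M E) (Ω : TwoForm E M) (x : E) : E →L[ℝ] E →L[ℝ] ℝ :=
  (Ω (e.symm x)).bilinearComp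
    (mfderiv 𝓘(ℝ, E) 𝓘(ℝ, E) e.symm x : E →L[ℝ] E)
    (mfderiv 𝓘(ℝ, E) 𝓘(ℝ, E) e.symm x : E →L[ℝ] E)

/-- Real holomorphic vector fields: smooth, and holomorphic in holomorphic coordinates
(equivalently `L_X J = 0`). -/
structure IsRealHolomorphic (X : VectorField E M) : Prop where
  smooth : ∀ e ∈ atlas E M, ContDiffOn ℝ ∞ (chartField e X) e.target
  holomorphic : ∀ e ∈ atlas E M, DifferentiableOn ℂ (chartField e X) e.target

/-- `i∂∂̄f` on `M`. -/
def ddbar (f : M → ℝ) : TwoForm E M := fun p =>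
  ddbarFlat (f ∘ (chartAt E p).symm) (chartAt E p p)

/-- The Lie derivative `L_X Ω` of a 2-form. -/
def lieDeriv (X : VectorField E M) (Ω : TwoForm E M) : TwoForm E M := fun p =>
  lieFlat (chartField (chartAt E p) X) (chartForm (chartAt E p) Ω) (chartAt E p p)

/-- The Ricci form of a Kähler form `Ω`: in holomorphic coordinates
`ρ = -i∂∂̄ log det (g_{jk̄})`, and `det (g_{jk̄})` is, up to a constant factor, the coefficient
of `Ωⁿ`. -/
def ricciForm [FiniteDimensional ℂ E] (Ω : TwoForm E M) : TwoForm E M := fun p =>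
  -ddbarFlat (fun x => Real.log (topCoeff (chartForm (chartAt E p) Ω x))) (chartAt E p p)

/-- The function `Ω'ⁿ / Ωⁿ`, `n = dim_ℂ M`. -/
def volumeRatio [FiniteDimensional ℂ E] (Ω' Ω : TwoForm E M) (p : M) : ℝ :=
  topCoeff (Ω' p) / topCoeff (Ω p)

/-- `Ω > 0`: positivity of `Ω(u, Ju)`. -/
def IsPositive (Ω : TwoForm E M) : Prop :=
  ∀ p : M, ∀ u : E, u ≠ 0 → 0 < Ω p u (Complex.I • u)

/-- Kähler forms: smooth closed positive real (1,1)-forms. -/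
structure IsKahlerForm (Ω : TwoForm E M) : Prop where
  smooth : ∀ e ∈ atlas E M, ContDiffOn ℝ ∞ (chartForm e Ω) e.target
  alternating : ∀ (p : M) (u : E), Ω p u u = 0
  typeOneOne : ∀ (p : M) (u v : E), Ω p (Complex.I • u) (Complex.I • v) = Ω p u v
  closed : ∀ e ∈ atlas E M, ∀ x ∈ e.target, ∀ u v w : E,
    fderiv ℝ (chartForm e Ω) x u v w + fderiv ℝ (chartForm e Ω) x v w u +
      fderiv ℝ (chartForm e Ω) x w u v = 0
  positive : IsPositive Ω

/-- The Riemannian distance of the metric `g(u, v) = Ω(u, Jv)`. -/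
def kahlerEDist (Ω : TwoForm E M) (p q : M) : ENNReal :=
  letI : ∀ x : M, ENorm (TangentSpace 𝓘(ℝ, E) x) := fun x =>
    ⟨fun u : E => ENNReal.ofReal (Real.sqrt (Ω x u (Complex.I • u)))⟩
  Manifold.riemannianEDist 𝓘(ℝ, E) p q

/-- Completeness of the metric of `Ω`: Cauchy sequences converge. -/
def IsCompleteMetric (Ω : TwoForm E M) : Prop :=
  ∀ s : ℕ → M,
    (∀ ε : ENNReal, 0 < ε → ∃ N, ∀ i ≥ N, ∀ j ≥ N, kahlerEDist Ω (s i) (s j) < ε) →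
      ∃ p, Filter.Tendsto s Filter.atTop (𝓝 p)

/-- The exponential map of the real torus `(S¹)ᵏ`, whose Lie algebra is `ℝᵏ`. -/
def torusExp {k : ℕ} (b : Fin k → ℝ) : Fin k → Circle := fun j => Circle.exp (b j)

/-- A smooth action of the real torus `(S¹)ᵏ` on `M` by biholomorphisms. Smoothness in the torus
variable is expressed on the universal cover `ℝᵏ`. -/
structure IsHolomorphicTorusAction (E : Type*) [NormedAddCommGroup E] [NormedSpace ℂ E]
    (M : Type*) [TopologicalSpace M] [ChartedSpace E M] (k : ℕ)
    [MulAction (Fin k → Circle) M] : Prop where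
  smooth : ContMDiff (𝓘(ℝ, Fin k → ℝ).prod 𝓘(ℝ, E)) 𝓘(ℝ, E) ∞
    (fun q : (Fin k → ℝ) × M => torusExp q.1 • q.2)
  holomorphic : ∀ t : Fin k → Circle, ContMDiff 𝓘(ℂ, E) 𝓘(ℂ, E) ω (fun p : M => t • p)

/-- The vector field `Y` belongs to the Lie algebra of the torus: it is the velocity field of a
one-parameter subgroup `s ↦ exp(s b)`. -/
def InTorusLieAlgebra (k : ℕ) [MulAction (Fin k → Circle) M] (Y : VectorField E M) : Prop :=
  ∃ b : Fin k → ℝ, ∀ p : M,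
    Y p = (mfderiv 𝓘(ℝ, ℝ) 𝓘(ℝ, E) (fun s : ℝ => torusExp (s • b) • p) 0 : ℝ →L[ℝ] E) 1

/-- Invariance of a 2-form under the torus action: `t^*Ω = Ω` for all `t`. -/
def IsTorusInvariant (k : ℕ) [MulAction (Fin k → Circle) M] (Ω : TwoForm E M) : Prop :=
  ∀ (t : Fin k → Circle) (p : M) (u v : E),
    Ω (t • p) ((mfderiv 𝓘(ℝ, E) 𝓘(ℝ, E) (fun q : M => t • q) p : E →L[ℝ] E) u)
      ((mfderiv 𝓘(ℝ, E) 𝓘(ℝ, E) (fun q : M => t • q) p : E →L[ℝ] E) v) = Ω p u v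

/-- The form `(i/2) ∂∂̄|z|^{2λ}` on `ℂ ∖ {0}`. -/
def coneForm (lam : ℝ) (z : ℂ) : ℂ →L[ℝ] ℂ →L[ℝ] ℝ :=
  (1 / 2 : ℝ) • ddbarFlat (fun w : ℂ => ‖w‖ ^ (2 * lam)) z

/-- `Ω` is a background metric on `M` for the vector field `X`: a complete torus-invariant Kähler
metric which, through a biholomorphism `ν` from the complement of a compact set `K ⊆ M` to the
complement of a compact set `Khat ⊆ ℂ × D`, is the product of the metric `(i/2)∂∂̄|z|^{2λ}` and of
`ΩD`, with `dν(X) = (2/λ) Re(z∂_z)`, and such that `ρ_Ω + ½ L_X Ω - Ω = i∂∂̄F₁` for a compactly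
supported `JX`-invariant smooth function `F₁`. -/
structure IsBackgroundMetric [FiniteDimensional ℂ E]
    {F : Type*} [NormedAddCommGroup F] [NormedSpace ℂ F]
    {D : Type*} [TopologicalSpace D] [ChartedSpace F D]
    (k : ℕ) [MulAction (Fin k → Circle) M]
    (X : VectorField E M) (Ω : TwoForm E M) (ΩD : TwoForm F D)
    (lam : ℝ) (K : Set M) (Khat : Set (ℂ × D))
    (ν : OpenPartialHomeomorph M (ℂ × D)) : Prop where
  kahler : IsKahlerForm Ω
  complete : IsCompleteMetric Ω
  torusInvariant : IsTorusInvariant k Ω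
  isCompact_K : IsCompact K
  isCompact_Khat : IsCompact Khat
  zeroFibre_subset : ∀ x : D, ((0 : ℂ), x) ∈ Khat
  source_eq : ν.source = Kᶜ
  target_eq : ν.target = Khatᶜ
  holomorphic : ContMDiffOn 𝓘(ℂ, E) (𝓘(ℂ, ℂ).prod 𝓘(ℂ, F)) ω ν ν.source
  holomorphic_symm : ContMDiffOn (𝓘(ℂ, ℂ).prod 𝓘(ℂ, F)) 𝓘(ℂ, E) ω ν.symm ν.target
  lam_pos : 0 < lam
  /-- The `ℂ`-component of `dν(X)`; the real vector field `Re(z∂_z)` has the value `z/2` at `z`. -/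
  map_field_fst : ∀ p ∈ ν.source,
    (mfderiv 𝓘(ℝ, E) 𝓘(ℝ, ℂ) (fun q => (ν q).1) p : E →L[ℝ] ℂ) (X p) =
      (2 / lam : ℝ) • ((ν p).1 / 2)
  /-- The `D`-component of `dν(X)`. -/
  map_field_snd : ∀ p ∈ ν.source,
    (mfderiv 𝓘(ℝ, E) 𝓘(ℝ, F) (fun q => (ν q).2) p : E →L[ℝ] F) (X p) = 0
  /-- `Ω` is the pullback by `ν` of the product form. -/
  pullback_eq : ∀ p ∈ ν.source, ∀ u v : E,
    Ω p u v =
      coneForm lam (ν p).1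
        ((mfderiv 𝓘(ℝ, E) 𝓘(ℝ, ℂ) (fun q => (ν q).1) p : E →L[ℝ] ℂ) u)
        ((mfderiv 𝓘(ℝ, E) 𝓘(ℝ, ℂ) (fun q => (ν q).1) p : E →L[ℝ] ℂ) v) +
      ΩD (ν p).2
        ((mfderiv 𝓘(ℝ, E) 𝓘(ℝ, F) (fun q => (ν q).2) p : E →L[ℝ] F) u)
        ((mfderiv 𝓘(ℝ, E) 𝓘(ℝ, F) (fun q => (ν q).2) p : E →L[ℝ] F) v)
  ricci_potential : ∃ F₁ : M → ℝ, IsSmooth E F₁ ∧ HasCompactSupport F₁ ∧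
    (∀ p, dirDeriv (rotate X) F₁ p = 0) ∧
    ricciForm Ω + (1 / 2 : ℝ) • lieDeriv X Ω - Ω = ddbar F₁

end Manifold

end KRSoliton

end

/-!
For a potential `f` put `MA(f) = log ((Ω + i∂∂̄f)ⁿ / Ωⁿ) - ½ X · f + f`. Since `X` is real
holomorphic, `L_X (i∂∂̄f) = i∂∂̄(X · f)`, so `i∂∂̄ MA(f)` is the difference of the forms
`ρ + ½ L_X - id` at `Ω` and at `Ω + i∂∂̄f`. If `Ω` has the soliton potential `F`, then `Ω + i∂∂̄f`
is a soliton exactly when `G = MA(f) - F` is pluriharmonic. As `G` is also `JX`-invariant,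
`d(X · G) = 0`, so `X · G` is a constant on the connected manifold `M`. Passing from `f` to
`f - G + const` leaves `i∂∂̄f` unchanged and turns `MA(f) = F + G` into `MA(f) = F + a` for any
prescribed `a`.
-/

namespace KRSoliton

/-! ### Flat calculus -/

section FlatCalculus

open ContinuousLinearMap (compL)

variable {E : Type*} [NormedAddCommGroup E] [NormedSpace ℂ E]
  {F : Type*} [NormedAddCommGroup F] [NormedSpace ℂ F]
  {H : Type*} [NormedAddCommGroup H] [NormedSpace ℝ H]
  {G : Type*} [NormedAddCommGroup G] [NormedSpace ℝ G]

lemma I_smul_I_smul (u : E) : Complex.I • Complex.I • u = -u := by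
  rw [smul_smul, Complex.I_mul_I, neg_one_smul]

lemma lieFlat_apply (V : E → E) (W : E → E →L[ℝ] E →L[ℝ] ℝ) (x u v : E) :
    lieFlat V W x u v = fderiv ℝ W x (V x) u v + W x (fderiv ℝ V x u) v +
      W x u (fderiv ℝ V x v) := by
  simp [lieFlat]

lemma lieFlat_congr {V₁ V₂ : E → E} {W₁ W₂ : E → E →L[ℝ] E →L[ℝ] ℝ} {x : E}
    (hV : V₁ =ᶠ[𝓝 x] V₂) (hW : W₁ =ᶠ[𝓝 x] W₂) : lieFlat V₁ W₁ x = lieFlat V₂ W₂ x := by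
  simp only [lieFlat, hV.fderiv_eq, hW.fderiv_eq, hV.eq_of_nhds, hW.eq_of_nhds]

lemma lieFlat_add (V : E → E) {W₁ W₂ : E → E →L[ℝ] E →L[ℝ] ℝ} {x : E}
    (h₁ : DifferentiableAt ℝ W₁ x) (h₂ : DifferentiableAt ℝ W₂ x) :
    lieFlat V (W₁ + W₂) x = lieFlat V W₁ x + lieFlat V W₂ x := by
  have h : fderiv ℝ (W₁ + W₂) x = fderiv ℝ W₁ x + fderiv ℝ W₂ x :=
    fderiv_add (𝕜 := ℝ) (F := E →L[ℝ] E →L[ℝ] ℝ) (f := W₁) (g := W₂) h₁ h₂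
  ext u v
  simp only [lieFlat_apply, h, Pi.add_apply, add_apply]
  ring

variable (E) in
/-- The operator `B ↦ ((u, v) ↦ (B(iu, v) - B(u, iv)) / 2)` on real bilinear forms, which takes the
real Hessian of `f` to `i∂∂̄f`. -/
noncomputable def oneOnePart : (E →L[ℝ] E →L[ℝ] ℝ) →L[ℝ] E →L[ℝ] E →L[ℝ] ℝ :=
  (1 / 2 : ℝ) • ((compL ℝ E E (E →L[ℝ] ℝ)).flip (mulI E) -
    compL ℝ E (E →L[ℝ] ℝ) (E →L[ℝ] ℝ) ((compL ℝ E E ℝ).flip (mulI E)))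

lemma oneOnePart_apply (B : E →L[ℝ] E →L[ℝ] ℝ) (u v : E) :
    oneOnePart E B u v = (1 / 2 : ℝ) * (B (Complex.I • u) v - B u (Complex.I • v)) := rfl

lemma oneOnePart_sub (B C : E →L[ℝ] E →L[ℝ] ℝ) :
    oneOnePart E (B - C) = oneOnePart E B - oneOnePart E C := by
  ext u v
  simp only [oneOnePart_apply, sub_apply]
  ring

lemma ddbarFlat_eq_oneOnePart (f : E → ℝ) (x : E) :
    ddbarFlat f x = oneOnePart E (fderiv ℝ (fderiv ℝ f) x) := rfl

lemma ddbarFlat_apply (f : E → ℝ) (x u v : E) :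
    ddbarFlat f x u v = (1 / 2 : ℝ) * (fderiv ℝ (fderiv ℝ f) x (Complex.I • u) v -
      fderiv ℝ (fderiv ℝ f) x u (Complex.I • v)) := rfl

lemma oneOnePart_I_smul_I_smul (B : E →L[ℝ] E →L[ℝ] ℝ) (u v : E) :
    oneOnePart E B (Complex.I • u) (Complex.I • v) = oneOnePart E B u v := by
  simp only [oneOnePart_apply, I_smul_I_smul, map_neg, neg_apply]
  ring

lemma oneOnePart_self {B : E →L[ℝ] E →L[ℝ] ℝ} (hB : ∀ u v, B u v = B v u) (u : E) :
    oneOnePart E B u u = 0 := by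
  rw [oneOnePart_apply, hB, sub_self, mul_zero]

lemma oneOnePart_eq_zero {B : E →L[ℝ] E →L[ℝ] ℝ}
    (hB : ∀ u v, B (Complex.I • u) v = B u (Complex.I • v)) : oneOnePart E B = 0 := by
  ext u v
  rw [oneOnePart_apply, hB, sub_self, mul_zero]
  rfl

lemma ddbarFlat_congr {f g : E → ℝ} {x : E} (h : f =ᶠ[𝓝 x] g) :
    ddbarFlat f x = ddbarFlat g x := by
  rw [ddbarFlat_eq_oneOnePart, ddbarFlat_eq_oneOnePart, h.fderiv.fderiv_eq]

lemma eventually_differentiableAt {f : H → G} {x : H} (hf : ContDiffAt ℝ 1 f x) :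
    ∀ᶠ y in 𝓝 x, DifferentiableAt ℝ f y :=
  (hf.eventually (by simp)).mono fun _ hy => hy.differentiableAt one_ne_zero

lemma contDiffAt_one_fderiv {f : H → G} {x : H} (hf : ContDiffAt ℝ 2 f x) :
    ContDiffAt ℝ 1 (fderiv ℝ f) x :=
  hf.fderiv_right one_add_one_eq_two.le

lemma differentiableAt_fderiv {f : H → G} {x : H} (hf : ContDiffAt ℝ 2 f x) :
    DifferentiableAt ℝ (fderiv ℝ f) x :=
  (contDiffAt_one_fderiv hf).differentiableAt one_ne_zero

lemma fderiv_fderiv_comm {f : H → G} {x : H} (hf : ContDiffAt ℝ 2 f x) (u v : H) :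
    fderiv ℝ (fderiv ℝ f) x u v = fderiv ℝ (fderiv ℝ f) x v u :=
  (hf.isSymmSndFDerivAt (by simp)).eq u v

lemma fderiv_clm_apply_const {K : Type*} [NormedAddCommGroup K] [NormedSpace ℝ K]
    {A : H → K →L[ℝ] G} {x : H} (hA : DifferentiableAt ℝ A x) (u : H) (v : K) :
    fderiv ℝ (fun y => A y v) x u = fderiv ℝ A x u v := by
  rw [fderiv_clm_apply hA (differentiableAt_const v)]
  simp only [fderiv_fun_const, Pi.zero_apply, ContinuousLinearMap.comp_zero, zero_add,
    ContinuousLinearMap.flip_apply]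

lemma fderiv_clm_map {K : Type*} [NormedAddCommGroup K] [NormedSpace ℝ K] (A : K →L[ℝ] G)
    {f : H → K} {x : H} (hf : DifferentiableAt ℝ f x) :
    fderiv ℝ (fun y => A (f y)) x = A.comp (fderiv ℝ f x) :=
  (A.hasFDerivAt.comp x hf.hasFDerivAt).fderiv

lemma contDiffAt_clm_map {K : Type*} [NormedAddCommGroup K] [NormedSpace ℝ K] (A : K →L[ℝ] G)
    {n : WithTop ℕ∞} {f : H → K} {x : H} (hf : ContDiffAt ℝ n f x) :
    ContDiffAt ℝ n (fun y => A (f y)) x :=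
  A.contDiff.contDiffAt.comp x hf

lemma ddbarFlat_add {f g : E → ℝ} {x : E} (hf : ContDiffAt ℝ 2 f x) (hg : ContDiffAt ℝ 2 g x) :
    ddbarFlat (f + g) x = ddbarFlat f x + ddbarFlat g x := by
  have h : fderiv ℝ (f + g) =ᶠ[𝓝 x] fderiv ℝ f + fderiv ℝ g := by
    filter_upwards [eventually_differentiableAt (hf.of_le one_le_two),
      eventually_differentiableAt (hg.of_le one_le_two)] with y hfy hgy using fderiv_add hfy hgy
  simp only [ddbarFlat_eq_oneOnePart]
  rw [h.fderiv_eq, fderiv_add (differentiableAt_fderiv hf) (differentiableAt_fderiv hg), map_add]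

lemma ddbarFlat_sub {f g : E → ℝ} {x : E} (hf : ContDiffAt ℝ 2 f x) (hg : ContDiffAt ℝ 2 g x) :
    ddbarFlat (f - g) x = ddbarFlat f x - ddbarFlat g x := by
  have h : fderiv ℝ (f - g) =ᶠ[𝓝 x] fderiv ℝ f - fderiv ℝ g := by
    filter_upwards [eventually_differentiableAt (hf.of_le one_le_two),
      eventually_differentiableAt (hg.of_le one_le_two)] with y hfy hgy using fderiv_sub hfy hgy
  simp only [ddbarFlat_eq_oneOnePart]
  rw [h.fderiv_eq, fderiv_sub (differentiableAt_fderiv hf) (differentiableAt_fderiv hg),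
    oneOnePart_sub]

lemma contDiffAt_ddbarFlat {f : E → ℝ} {x : E} (hf : ContDiffAt ℝ ∞ f x) :
    ContDiffAt ℝ ∞ (ddbarFlat f) x :=
  have hf' : ContDiffAt ℝ ∞ (fderiv ℝ f) x := hf.fderiv_right le_rfl
  have hf'' : ContDiffAt ℝ ∞ (fderiv ℝ (fderiv ℝ f)) x := hf'.fderiv_right le_rfl
  contDiffAt_clm_map (K := E →L[ℝ] E →L[ℝ] ℝ) (G := E →L[ℝ] E →L[ℝ] ℝ) (oneOnePart E) hf''

lemma ddbarFlat_const_smul (c : ℝ) {f : E → ℝ} {x : E} (hf : ContDiffAt ℝ 2 f x) :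
    ddbarFlat (c • f) x = c • ddbarFlat f x := by
  have h : fderiv ℝ (c • f) =ᶠ[𝓝 x] c • fderiv ℝ f := by
    filter_upwards [eventually_differentiableAt (hf.of_le one_le_two)] with y hy
      using fderiv_const_smul hy c
  simp only [ddbarFlat_eq_oneOnePart]
  rw [h.fderiv_eq, fderiv_const_smul (differentiableAt_fderiv hf), map_smul]

lemma fderiv_I_smul {g : E → F} {x : E} (hg : DifferentiableAt ℂ g x) (v : E) :
    fderiv ℝ g x (Complex.I • v) = Complex.I • fderiv ℝ g x v := by
  rw [hg.fderiv_restrictScalars ℝ]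
  exact map_smul (fderiv ℂ g x) _ _

lemma fderiv_fderiv_I_smul {g : E → F} {x : E} (hg : ContDiffAt ℝ 2 g x)
    (hgc : ∀ᶠ y in 𝓝 x, DifferentiableAt ℂ g y) (u v : E) :
    fderiv ℝ (fderiv ℝ g) x u (Complex.I • v) = Complex.I • fderiv ℝ (fderiv ℝ g) x u v := by
  have h : (fun y => fderiv ℝ g y (Complex.I • v)) =ᶠ[𝓝 x]
      fun y => Complex.I • fderiv ℝ g y v := hgc.mono fun y hy => fderiv_I_smul hy v
  have hd := differentiableAt_fderiv hg
  rw [← fderiv_clm_apply_const hd, ← fderiv_clm_apply_const hd, h.fderiv_eq,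
    fderiv_fun_const_smul (hd.clm_apply (differentiableAt_const v))]
  rfl

lemma fderiv_fderiv_I_smul_left {g : E → F} {x : E} (hg : ContDiffAt ℝ 2 g x)
    (hgc : ∀ᶠ y in 𝓝 x, DifferentiableAt ℂ g y) (u v : E) :
    fderiv ℝ (fderiv ℝ g) x (Complex.I • u) v = fderiv ℝ (fderiv ℝ g) x u (Complex.I • v) := by
  rw [fderiv_fderiv_comm hg, fderiv_fderiv_I_smul hg hgc, fderiv_fderiv_I_smul hg hgc,
    fderiv_fderiv_comm hg]

lemma fderiv_fderiv_comp_apply {K : Type*} [NormedAddCommGroup K] [NormedSpace ℝ K] {g : H → K}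
    {f : K → G} {x : H} (hf : ContDiffAt ℝ 2 f (g x)) (hg : ContDiffAt ℝ 2 g x) (u v : H) :
    fderiv ℝ (fderiv ℝ (f ∘ g)) x u v =
      fderiv ℝ (fderiv ℝ f) (g x) (fderiv ℝ g x u) (fderiv ℝ g x v) +
        fderiv ℝ f (g x) (fderiv ℝ (fderiv ℝ g) x u v) := by
  have hgx : DifferentiableAt ℝ g x := hg.differentiableAt two_ne_zero
  have hf' : DifferentiableAt ℝ (fderiv ℝ f) (g x) := differentiableAt_fderiv hf
  have h : fderiv ℝ (f ∘ g) =ᶠ[𝓝 x] fun y => (fderiv ℝ f (g y)).comp (fderiv ℝ g y) := by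
    filter_upwards [hgx.continuousAt.eventually
      (eventually_differentiableAt (hf.of_le one_le_two)),
      eventually_differentiableAt (hg.of_le one_le_two)] with y hfy hgy using fderiv_comp y hfy hgy
  rw [h.fderiv_eq, fderiv_clm_comp (c := fun y => fderiv ℝ f (g y)) (hf'.comp x hgx)
    (differentiableAt_fderiv hg), fderiv_fun_comp x hf' hgx]
  simp [add_comm]

lemma ddbarFlat_comp {g : E → F} {f : F → ℝ} {x : E} (hf : ContDiffAt ℝ 2 f (g x))
    (hg : ContDiffAt ℝ 2 g x) (hgc : ∀ᶠ y in 𝓝 x, DifferentiableAt ℂ g y) :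
    ddbarFlat (f ∘ g) x = (ddbarFlat f (g x)).bilinearComp (fderiv ℝ g x) (fderiv ℝ g x) := by
  ext u v
  rw [ContinuousLinearMap.bilinearComp_apply, ddbarFlat_apply, ddbarFlat_apply,
    fderiv_fderiv_comp_apply hf hg, fderiv_fderiv_comp_apply hf hg,
    fderiv_fderiv_I_smul_left hg hgc, fderiv_I_smul hgc.self_of_nhds,
    fderiv_I_smul hgc.self_of_nhds]
  ring

lemma fderiv_fderiv_apply_field {f : H → G} {V : H → H} {x : H} (hf : ContDiffAt ℝ 2 f x)
    (hV : DifferentiableAt ℝ V x) :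
    fderiv ℝ (fun y => fderiv ℝ f y (V y)) x =
      fderiv ℝ (fderiv ℝ f) x (V x) + (fderiv ℝ f x).comp (fderiv ℝ V x) := by
  ext u
  rw [fderiv_clm_apply (differentiableAt_fderiv hf) hV, add_comm, add_apply, add_apply,
    ContinuousLinearMap.flip_apply, fderiv_fderiv_comm hf]

lemma lieFlat_fderiv_fderiv {f : E → ℝ} {V : E → E} {x : E} (hf : ContDiffAt ℝ 3 f x)
    (hV : ContDiffAt ℝ 2 V x) :
    lieFlat V (fderiv ℝ (fderiv ℝ f)) x =
      fderiv ℝ (fderiv ℝ fun y => fderiv ℝ f y (V y)) x -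
        (compL ℝ E E ℝ (fderiv ℝ f x)).comp (fderiv ℝ (fderiv ℝ V) x) := by
  have hf₂ : ContDiffAt ℝ 2 f x := hf.of_le (by norm_num)
  have hf' : ContDiffAt ℝ 2 (fderiv ℝ f) x := hf.fderiv_right (by norm_num)
  have hV' : DifferentiableAt ℝ V x := hV.differentiableAt two_ne_zero
  have h : fderiv ℝ (fun y => fderiv ℝ f y (V y)) =ᶠ[𝓝 x]
      fun y => fderiv ℝ (fderiv ℝ f) y (V y) + (fderiv ℝ f y).comp (fderiv ℝ V y) := by
    filter_upwards [hf₂.eventually (by simp),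
      eventually_differentiableAt (hV.of_le one_le_two)] with y hfy hVy
      using fderiv_fderiv_apply_field hfy hVy
  rw [h.fderiv_eq, fderiv_fun_add ((differentiableAt_fderiv hf').clm_apply hV')
    ((differentiableAt_fderiv hf₂).clm_comp (differentiableAt_fderiv hV)),
    fderiv_fderiv_apply_field hf' hV',
    fderiv_clm_comp (differentiableAt_fderiv hf₂) (differentiableAt_fderiv hV)]
  ext u v
  simp only [lieFlat_apply, ContinuousLinearMap.comp_apply, add_apply, sub_apply,
    ContinuousLinearMap.compL_apply, ContinuousLinearMap.flip_apply]
  ring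

lemma lieFlat_oneOnePart {V : E → E} {W : E → E →L[ℝ] E →L[ℝ] ℝ} {x : E}
    (hW : DifferentiableAt ℝ W x)
    (hV : ∀ u, fderiv ℝ V x (Complex.I • u) = Complex.I • fderiv ℝ V x u) :
    lieFlat V (fun y => oneOnePart E (W y)) x = oneOnePart E (lieFlat V W x) := by
  have h : fderiv ℝ (fun y => oneOnePart E (W y)) x = (oneOnePart E).comp (fderiv ℝ W x) :=
    fderiv_clm_map (K := E →L[ℝ] E →L[ℝ] ℝ) (G := E →L[ℝ] E →L[ℝ] ℝ) (oneOnePart E) (f := W) hW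
  ext u v
  simp only [lieFlat_apply, h, oneOnePart_apply, ContinuousLinearMap.comp_apply, hV]
  ring

lemma lieFlat_ddbarFlat {f : E → ℝ} {V : E → E} {x : E} (hf : ContDiffAt ℝ 3 f x)
    (hV : ContDiffAt ℝ 2 V x) (hVc : ∀ᶠ y in 𝓝 x, DifferentiableAt ℂ V y) :
    lieFlat V (ddbarFlat f) x = ddbarFlat (fun y => fderiv ℝ f y (V y)) x := by
  have hf' : ContDiffAt ℝ 2 (fderiv ℝ f) x := hf.fderiv_right (by norm_num)
  have hzero : oneOnePart E ((compL ℝ E E ℝ (fderiv ℝ f x)).comp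
      (fderiv ℝ (fderiv ℝ V) x)) = 0 :=
    oneOnePart_eq_zero fun u v =>
      congrArg (fderiv ℝ f x) (fderiv_fderiv_I_smul_left hV hVc u v)
  rw [show ddbarFlat f = fun y => oneOnePart E (fderiv ℝ (fderiv ℝ f) y) from rfl,
    lieFlat_oneOnePart (differentiableAt_fderiv hf') (fderiv_I_smul hVc.self_of_nhds),
    lieFlat_fderiv_fderiv hf hV, oneOnePart_sub, hzero]
  exact sub_zero (oneOnePart E (fderiv ℝ (fderiv ℝ fun y => fderiv ℝ f y (V y)) x))

section InvariantFunction

variable {f : E → ℝ} {V : E → E} {x : E}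

lemma fderiv_fderiv_I_smul_field (hf : ContDiffAt ℝ 2 f x) (hV : DifferentiableAt ℂ V x)
    (hfV : ∀ᶠ y in 𝓝 x, fderiv ℝ f y (Complex.I • V y) = 0) (u : E) :
    fderiv ℝ (fderiv ℝ f) x u (Complex.I • V x) +
      fderiv ℝ f x (Complex.I • fderiv ℝ V x u) = 0 := by
  have hVr : DifferentiableAt ℝ V x := hV.restrictScalars ℝ
  have h := fderiv_fderiv_apply_field hf (V := fun y => Complex.I • V y) (hVr.const_smul _)
  rw [Filter.EventuallyEq.fderiv_eq (f := fun _ => (0 : ℝ)) hfV, fderiv_fun_const,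
    fderiv_fun_const_smul hVr] at h
  simpa [fderiv_fderiv_comm hf u] using (DFunLike.congr_fun h u).symm

lemma fderiv_apply_field_I_smul_field (hf : ContDiffAt ℝ 2 f x) (hV : DifferentiableAt ℂ V x)
    (hfV : ∀ᶠ y in 𝓝 x, fderiv ℝ f y (Complex.I • V y) = 0) :
    fderiv ℝ (fun y => fderiv ℝ f y (V y)) x (Complex.I • V x) = 0 := by
  rw [fderiv_fderiv_apply_field hf (hV.restrictScalars ℝ), add_apply,
    ContinuousLinearMap.comp_apply, fderiv_I_smul hV]
  exact fderiv_fderiv_I_smul_field hf hV hfV (V x)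

lemma fderiv_apply_field_eq_zero (hf : ContDiffAt ℝ 2 f x) (hV : DifferentiableAt ℂ V x)
    (hfV : ∀ᶠ y in 𝓝 x, fderiv ℝ f y (Complex.I • V y) = 0) (hdd : ddbarFlat f x = 0) :
    fderiv ℝ (fun y => fderiv ℝ f y (V y)) x = 0 := by
  ext u
  have hinv := fderiv_fderiv_I_smul_field hf hV hfV (Complex.I • u)
  have hpluri : ddbarFlat f x u (Complex.I • V x) = 0 := by rw [hdd]; rfl
  rw [fderiv_I_smul hV, I_smul_I_smul, map_neg] at hinv
  rw [ddbarFlat_apply, I_smul_I_smul, map_neg] at hpluri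
  rw [fderiv_fderiv_apply_field hf (hV.restrictScalars ℝ), add_apply,
    ContinuousLinearMap.comp_apply, fderiv_fderiv_comm hf, zero_apply]
  linarith

end InvariantFunction

section Flow

variable {Θ : ℝ × E → E} {x : E}

lemma eventually_fderiv_slice_eq (hΘ : ContDiffAt ℝ 1 Θ (0, x)) (u : E) :
    (fun s => fderiv ℝ (fun y => Θ (s, y)) x u) =ᶠ[𝓝 0] fun s => fderiv ℝ Θ (s, x) (0, u) := by
  have hcont : Filter.Tendsto (fun s : ℝ => (s, x)) (𝓝 0) (𝓝 (0, x)) :=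
    (continuous_id.prodMk continuous_const).tendsto 0
  filter_upwards [hcont.eventually (eventually_differentiableAt hΘ)] with s hs
  exact DFunLike.congr_fun (hs.hasFDerivAt.comp x (hasFDerivAt_prodMk_right s x)).fderiv u

lemma hasDerivAt_fderiv_slice (hΘ : ContDiffAt ℝ 2 Θ (0, x)) (u : E) :
    HasDerivAt (fun s => fderiv ℝ (fun y => Θ (s, y)) x u)
      (fderiv ℝ (fun y => fderiv ℝ Θ (0, y) (1, 0)) x u) 0 := by
  have hd : HasFDerivAt (fderiv ℝ Θ) (fderiv ℝ (fderiv ℝ Θ) (0, x)) (0, x) :=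
    (differentiableAt_fderiv hΘ).hasFDerivAt
  have htime : HasDerivAt (fun s : ℝ => fderiv ℝ Θ (s, x))
      (fderiv ℝ (fderiv ℝ Θ) (0, x) (1, 0)) 0 :=
    hd.comp_hasDerivAt (0 : ℝ) ((hasDerivAt_id (0 : ℝ)).prodMk (hasDerivAt_const 0 x))
  have hspace : HasFDerivAt (fun y => fderiv ℝ Θ (0, y))
      ((fderiv ℝ (fderiv ℝ Θ) (0, x)).comp (ContinuousLinearMap.inr ℝ ℝ E)) x :=
    hd.comp x (hasFDerivAt_prodMk_right 0 x)
  refine ((htime.clm_apply (hasDerivAt_const 0 ((0, u) : ℝ × E))).congr_of_eventuallyEq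
    (eventually_fderiv_slice_eq (hΘ.of_le one_le_two) u)).congr_deriv ?_
  rw [fderiv_clm_apply_const hspace.differentiableAt, hspace.fderiv, map_zero, add_zero]
  exact fderiv_fderiv_comm hΘ (1, 0) (0, u)

lemma hasDerivAt_pullback (hΘ : ContDiffAt ℝ 2 Θ (0, x)) (h0 : ∀ᶠ y in 𝓝 x, Θ (0, y) = y)
    {W : E → E →L[ℝ] E →L[ℝ] ℝ} (hW : DifferentiableAt ℝ W x) (u v : E) :
    HasDerivAt (fun s => W (Θ (s, x)) (fderiv ℝ (fun y => Θ (s, y)) x u)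
        (fderiv ℝ (fun y => Θ (s, y)) x v))
      (lieFlat (fun y => fderiv ℝ Θ (0, y) (1, 0)) W x u v) 0 := by
  have hx : Θ (0, x) = x := h0.self_of_nhds
  have hid : fderiv ℝ (fun y => Θ (0, y)) x = ContinuousLinearMap.id ℝ E := by
    rw [Filter.EventuallyEq.fderiv_eq (f := id) h0, fderiv_id]
  have hΘs : HasDerivAt (fun s => Θ (s, x)) (fderiv ℝ Θ (0, x) (1, 0)) 0 :=
    (hΘ.differentiableAt two_ne_zero).hasFDerivAt.comp_hasDerivAt (0 : ℝ)
      ((hasDerivAt_id (0 : ℝ)).prodMk (hasDerivAt_const 0 x))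
  have hWs : HasDerivAt (fun s => W (Θ (s, x))) _ 0 :=
    HasFDerivAt.comp_hasDerivAt (0 : ℝ) (l := W)
      (l' := fderiv ℝ W x) (by rw [hx]; exact hW.hasFDerivAt) hΘs
  refine ((hWs.clm_apply (hasDerivAt_fderiv_slice hΘ u)).clm_apply
    (hasDerivAt_fderiv_slice hΘ v)).congr_deriv ?_
  simp only [lieFlat_apply, hid, hx, add_apply, ContinuousLinearMap.id_apply]

end Flow

end FlatCalculus

/-! ### Top powers of two-forms -/

lemma hasDerivAt_det_one_add_smul {V : Type*} [AddCommGroup V] [Module ℝ V]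
    [FiniteDimensional ℝ V] (f : V →ₗ[ℝ] V) :
    HasDerivAt (fun t : ℝ => LinearMap.det (1 + t • f)) (LinearMap.trace ℝ V f) 0 := by
  let b := Module.finBasis ℝ V
  let A := LinearMap.toMatrix b b f
  let p := (1 + (Polynomial.X : Polynomial ℝ) • A.map Polynomial.C).det
  have hp (t : ℝ) : LinearMap.det (1 + t • f) = p.eval t := by
    rw [← LinearMap.det_toMatrix b]
    simp [p, A, eval_det, ← Matrix.smul_eq_mul_diagonal]
  simp only [hp]
  rw [LinearMap.trace_eq_matrix_trace ℝ b, ← Matrix.derivative_det_one_add_X_smul]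
  exact p.hasDerivAt 0

lemma hasDerivAt_add_smul_add_sq_smul {V : Type*} [NormedAddCommGroup V] [NormedSpace ℝ V]
    (a b c : V) : HasDerivAt (fun t : ℝ => a + t • b + t ^ 2 • c) b 0 := by
  simpa using (((hasDerivAt_id (0 : ℝ)).smul_const b).const_add a).fun_add
    ((hasDerivAt_pow 2 (0 : ℝ)).smul_const c)

section TopPower

variable {E : Type*} [NormedAddCommGroup E] [NormedSpace ℂ E]

/-- The real frame `b₁, i b₁, b₂, i b₂, …` of a complex basis `b`, as a basis of the underlying real
vector space. -/
noncomputable def realBasis {n : ℕ} (b : Module.Basis (Fin n) ℂ E) :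
    Module.Basis (Fin n × Fin 2) ℝ E :=
  Complex.basisOneI.smulTower' b

lemma realBasis_zero {n : ℕ} (b : Module.Basis (Fin n) ℂ E) (j : Fin n) :
    realBasis b (j, 0) = b j := by
  simp [realBasis, Module.Basis.smulTower'_apply]

lemma realBasis_one {n : ℕ} (b : Module.Basis (Fin n) ℂ E) (j : Fin n) :
    realBasis b (j, 1) = Complex.I • b j := by
  simp [realBasis, Module.Basis.smulTower'_apply]

lemma frame_eq_realBasis [FiniteDimensional ℂ E] :
    frame E = realBasis (Module.finBasis ℂ E) := by
  ext1 ⟨j, l⟩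
  fin_cases l
  · simp [frame, realBasis_zero]
  · simp [frame, realBasis_one]

lemma prod_pairs_update {k : ℕ} [DecidableEq (Fin k × Fin 2)] (α : E →L[ℝ] E →L[ℝ] ℝ)
    (v : Fin k × Fin 2 → E) (j : Fin k) (l : Fin 2) (z : E) :
    ∏ i, α (Function.update v (j, l) z (i, 0)) (Function.update v (j, l) z (i, 1)) =
      α (Function.update v (j, l) z (j, 0)) (Function.update v (j, l) z (j, 1)) *
        ∏ i ∈ Finset.univ.erase j, α (v (i, 0)) (v (i, 1)) := by
  rw [← Finset.mul_prod_erase _ _ (Finset.mem_univ j)]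
  congr 1
  refine Finset.prod_congr rfl fun i hi => ?_
  have hij := Finset.ne_of_mem_erase hi
  rw [Function.update_of_ne (by simp [hij]), Function.update_of_ne (by simp [hij])]

/-- The multilinear map `v ↦ ∏ᵢ α(v_{i,0}, v_{i,1})`, whose alternatization is, up to a factor, the
`k`-fold wedge power of `α`. -/
noncomputable def pairProd (α : E →L[ℝ] E →L[ℝ] ℝ) (k : ℕ) :
    MultilinearMap ℝ (fun _ : Fin k × Fin 2 => E) ℝ where
  toFun v := ∏ i : Fin k, α (v (i, 0)) (v (i, 1))
  map_update_add' v j x y := by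
    obtain ⟨j, l⟩ := j
    simp only [prod_pairs_update, ← add_mul]
    congr 1
    fin_cases l <;> simp
  map_update_smul' v j c x := by
    obtain ⟨j, l⟩ := j
    simp only [prod_pairs_update, smul_eq_mul, ← mul_assoc]
    congr 1
    fin_cases l <;> simp

lemma wedgePow_eq_alternatization (α : E →L[ℝ] E →L[ℝ] ℝ) (k : ℕ) (v : Fin k × Fin 2 → E) :
    wedgePow α k v = (1 / 2 : ℝ) ^ k * MultilinearMap.alternatization (pairProd α k) v := by
  rw [wedgePow, MultilinearMap.alternatization_apply]
  congr 1
  refine Finset.sum_congr rfl fun σ _ => ?_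
  rw [Units.smul_def, zsmul_eq_mul]
  rfl

lemma wedgePow_bilinearComp (α : E →L[ℝ] E →L[ℝ] ℝ) (A : E →L[ℝ] E) (k : ℕ)
    (v : Fin k × Fin 2 → E) :
    wedgePow (α.bilinearComp A A) k v = wedgePow α k (A ∘ v) := rfl

lemma wedgePow_eq_det_mul {n : ℕ} (b : Module.Basis (Fin n × Fin 2) ℝ E)
    (α : E →L[ℝ] E →L[ℝ] ℝ) (v : Fin n × Fin 2 → E) :
    wedgePow α n v = b.det v * wedgePow α n b := by
  rw [wedgePow_eq_alternatization, wedgePow_eq_alternatization,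
    AlternatingMap.eq_smul_basis_det b (MultilinearMap.alternatization (pairProd α n))]
  simp only [AlternatingMap.smul_apply, smul_eq_mul, Module.Basis.det_self]
  ring

section TopCoeff

variable [FiniteDimensional ℂ E]

lemma contDiff_topCoeff : ContDiff ℝ ∞ (topCoeff : (E →L[ℝ] E →L[ℝ] ℝ) → ℝ) := by
  unfold topCoeff wedgePow
  refine contDiff_const.mul (ContDiff.sum fun σ _ => contDiff_const.mul ?_)
  refine contDiff_prod fun i _ => ?_
  exact (contDiff_id.clm_apply contDiff_const).clm_apply contDiff_const

lemma topCoeff_bilinearComp (α : E →L[ℝ] E →L[ℝ] ℝ) (A : E →L[ℝ] E) :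
    topCoeff (α.bilinearComp A A) = LinearMap.det (A : E →ₗ[ℝ] E) * topCoeff α := by
  let b := realBasis (Module.finBasis ℂ E)
  have hdet : b.det (A ∘ b) = LinearMap.det (A : E →ₗ[ℝ] E) := by
    rw [← mul_one (LinearMap.det _), ← b.det_self]
    exact b.det_comp (A : E →ₗ[ℝ] E) b
  rw [topCoeff, topCoeff, frame_eq_realBasis, wedgePow_bilinearComp, wedgePow_eq_det_mul b, hdet]

lemma topCoeff_ne_zero_of_basis {α : E →L[ℝ] E →L[ℝ] ℝ}
    (b : Module.Basis (Fin (Module.finrank ℂ E)) ℂ E)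
    (h : wedgePow α (Module.finrank ℂ E) (realBasis b) ≠ 0) : topCoeff α ≠ 0 := by
  rw [wedgePow_eq_det_mul (realBasis (Module.finBasis ℂ E))] at h
  rw [topCoeff, frame_eq_realBasis]
  exact right_ne_zero_of_mul h

lemma fderiv_topCoeff_apply (α : E →L[ℝ] E →L[ℝ] ℝ) (A : E →L[ℝ] E) :
    fderiv ℝ topCoeff α (α.bilinearComp A (.id ℝ E) + α.bilinearComp (.id ℝ E) A) =
      LinearMap.trace ℝ E A * topCoeff α := by
  let c : ℝ → E →L[ℝ] E →L[ℝ] ℝ := fun t => α.bilinearComp (1 + t • A) (1 + t • A)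
  have hc : HasDerivAt c (α.bilinearComp A (.id ℝ E) + α.bilinearComp (.id ℝ E) A) 0 := by
    have hcurve : c = fun t => α + t • (α.bilinearComp A (.id ℝ E) + α.bilinearComp (.id ℝ E) A) +
        t ^ 2 • α.bilinearComp A A := by
      ext t u v
      simp [c]
      ring
    rw [hcurve]
    exact hasDerivAt_add_smul_add_sq_smul (V := E →L[ℝ] E →L[ℝ] ℝ) _ _ _
  have hc0 : c 0 = α := by
    ext u v
    simp [c]
  have hdet : topCoeff ∘ c =
      fun t => LinearMap.det (1 + t • (A : E →ₗ[ℝ] E)) * topCoeff α :=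
    funext fun t => topCoeff_bilinearComp α (1 + t • A)
  have htop := ((contDiff_topCoeff (E := E)).differentiable (by simp) (c 0)).hasFDerivAt
  have h := htop.comp_hasDerivAt (0 : ℝ) hc
  rw [hc0, hdet] at h
  exact h.unique ((hasDerivAt_det_one_add_smul (A : E →ₗ[ℝ] E)).mul_const _)

lemma fderiv_topCoeff_comp_apply {V : E → E} {W : E → E →L[ℝ] E →L[ℝ] ℝ} {x : E}
    (hW : DifferentiableAt ℝ W x) (h : lieFlat V W x = 0) :
    fderiv ℝ (fun y => topCoeff (W y)) x (V x) =
      -(LinearMap.trace ℝ E (fderiv ℝ V x : E →ₗ[ℝ] E) * topCoeff (W x)) := by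
  have hWV : fderiv ℝ W x (V x) = -((W x).bilinearComp (fderiv ℝ V x) (.id ℝ E) +
      (W x).bilinearComp (.id ℝ E) (fderiv ℝ V x)) := by
    ext u v
    have huv : lieFlat V W x u v = 0 := by simp [h]
    rw [lieFlat_apply] at huv
    simp only [neg_apply, add_apply, ContinuousLinearMap.bilinearComp_apply,
      ContinuousLinearMap.id_apply]
    linarith
  have htop := (contDiff_topCoeff (E := E)).differentiable (by simp) (W x)
  rw [← fderiv_topCoeff_apply, ← map_neg, ← hWV]
  exact congrArg (fun L => L (V x)) (fderiv_comp x htop hW)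

end TopCoeff

lemma exists_eq_prodCongrLeft_mul_prodCongrRight {ι κ : Type*} [Finite ι] [Nonempty κ]
    {σ : Equiv.Perm (ι × κ)} (hσ : ∀ i k l, (σ (i, k)).1 = (σ (i, l)).1) :
    ∃ (π : Equiv.Perm ι) (τ : ι → Equiv.Perm κ),
      σ = (Equiv.prodCongrLeft fun _ => π) * Equiv.prodCongrRight τ := by
  obtain ⟨k₀⟩ := ‹Nonempty κ›
  let f : ι → ι := fun i => (σ (i, k₀)).1
  have hf : Function.Bijective f := Finite.surjective_iff_bijective.1 fun j => by
    obtain ⟨⟨i, k⟩, hik⟩ := σ.surjective (j, k₀)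
    exact ⟨i, by simp only [f, hσ i k₀ k, hik]⟩
  have hg (i : ι) : Function.Bijective fun k => (σ (i, k)).2 := by
    refine ⟨fun k l hkl => congrArg Prod.snd (σ.injective (Prod.ext (hσ i k l) hkl)), fun l => ?_⟩
    obtain ⟨⟨j, k⟩, hjk⟩ := σ.surjective (f i, l)
    have hji : j = i := hf.1 (by simp only [f, hσ j k₀ k, hjk])
    exact ⟨k, by rw [← hji]; simp only [hjk]⟩
  refine ⟨.ofBijective f hf, fun i => .ofBijective _ (hg i), Equiv.ext fun ⟨i, k⟩ => ?_⟩
  exact Prod.ext (hσ i k k₀) rfl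

lemma exists_basis_inner_eq_ite {V : Type*} [AddCommGroup V] [Module ℂ V] [FiniteDimensional ℂ V]
    (c : InnerProductSpace.Core ℂ V) :
    ∃ b : Module.Basis (Fin (Module.finrank ℂ V)) ℂ V,
      ∀ i j, c.inner (b i) (b j) = if i = j then 1 else 0 := by
  let _ : NormedAddCommGroup V := c.toNormedAddCommGroup
  let _ : InnerProductSpace ℂ V := InnerProductSpace.ofCore c.toCore
  refine ⟨(stdOrthonormalBasis ℂ V).toBasis, fun i j => ?_⟩
  simpa using orthonormal_iff_ite.1 (stdOrthonormalBasis ℂ V).orthonormal i j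

/-- Positive real `(1,1)`-forms on a complex vector space. -/
structure IsPositiveOneOne (α : E →L[ℝ] E →L[ℝ] ℝ) : Prop where
  alternating : ∀ u, α u u = 0
  typeOneOne : ∀ u v, α (Complex.I • u) (Complex.I • v) = α u v
  positive : ∀ u, u ≠ 0 → 0 < α u (Complex.I • u)

namespace IsPositiveOneOne

variable {α : E →L[ℝ] E →L[ℝ] ℝ}

lemma apply_swap (hα : IsPositiveOneOne α) (u v : E) : α u v = -α v u := by
  have := hα.alternating (u + v)
  simp only [map_add, add_apply, hα.alternating] at this
  linarith

lemma apply_I_smul_left (hα : IsPositiveOneOne α) (u v : E) :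
    α (Complex.I • u) v = -α u (Complex.I • v) := by
  rw [← hα.typeOneOne u (Complex.I • v), I_smul_I_smul, map_neg, neg_neg]

lemma apply_I_smul_comm (hα : IsPositiveOneOne α) (u v : E) :
    α u (Complex.I • v) = α v (Complex.I • u) := by
  rw [hα.apply_swap, hα.apply_I_smul_left, neg_neg]

/-- The Hermitian inner product `h(u, v) = α(u, iv) + i α(u, v)` with imaginary part `α`. -/
@[reducible]
noncomputable def hermitianCore (hα : IsPositiveOneOne α) : InnerProductSpace.Core ℂ E where
  inner u v := ⟨α u (Complex.I • v), α u v⟩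
  conj_inner_symm u v :=
    Complex.ext (hα.apply_I_smul_comm v u) (neg_eq_iff_eq_neg.2 (hα.apply_swap v u))
  re_inner_nonneg u := by
    rcases eq_or_ne u 0 with rfl | hu
    · simp
    · exact (hα.positive u hu).le
  add_left u v w := Complex.ext (by simp) (by simp)
  smul_left u v r := by
    have hr : r • u = r.re • u + r.im • (Complex.I • u) := by
      conv_lhs => rw [← Complex.re_add_im r, add_smul, mul_smul]
      simp
    rw [hr]
    apply Complex.ext <;> simp [hα.apply_I_smul_left, I_smul_I_smul]
  definite u hu := by
    by_contra h
    exact (hα.positive u h).ne' (congrArg Complex.re hu)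

lemma exists_unitary_basis [FiniteDimensional ℂ E] (hα : IsPositiveOneOne α) :
    ∃ b : Module.Basis (Fin (Module.finrank ℂ E)) ℂ E, (∀ i j, α (b i) (b j) = 0) ∧
      ∀ i j, α (b i) (Complex.I • b j) = if i = j then 1 else 0 := by
  obtain ⟨b, hb⟩ := exists_basis_inner_eq_ite hα.hermitianCore
  refine ⟨b, fun i j => ?_, fun i j => ?_⟩
  · refine (congrArg Complex.im (hb i j)).trans ?_
    split_ifs <;> simp
  · refine (congrArg Complex.re (hb i j)).trans ?_
    split_ifs <;> simp

section UnitaryBasis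

variable {n : ℕ} {b : Module.Basis (Fin n) ℂ E} (hb₀ : ∀ i j, α (b i) (b j) = 0)
  (hb₁ : ∀ i j, α (b i) (Complex.I • b j) = if i = j then 1 else 0)
include hb₁

lemma apply_realBasis_perm (hα : IsPositiveOneOne α) (i : Fin n) (τ : Equiv.Perm (Fin 2)) :
    α (realBasis b (i, τ 0)) (realBasis b (i, τ 1)) = ((Equiv.Perm.sign τ : ℤ) : ℝ) := by
  have hτ : τ = 1 ∨ τ = Equiv.swap 0 1 := by
    revert τ
    decide
  rcases hτ with rfl | rfl <;>
    simp [realBasis_zero, realBasis_one, hα.apply_I_smul_left, hb₁]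

include hb₀

lemma apply_realBasis_of_fst_ne (hα : IsPositiveOneOne α) {p q : Fin n × Fin 2} (h : p.1 ≠ q.1) :
    α (realBasis b p) (realBasis b q) = 0 := by
  obtain ⟨i, l⟩ := p
  obtain ⟨j, m⟩ := q
  have hij : i ≠ j := h
  fin_cases l <;> fin_cases m <;>
    simp [realBasis_zero, realBasis_one, hα.typeOneOne, hα.apply_I_smul_left, hb₀, hb₁, hij]

lemma sign_mul_prod_nonneg (hα : IsPositiveOneOne α) (σ : Equiv.Perm (Fin n × Fin 2)) :
    0 ≤ ((Equiv.Perm.sign σ : ℤ) : ℝ) *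
      ∏ i, α (realBasis b (σ (i, 0))) (realBasis b (σ (i, 1))) := by
  by_cases hσ : ∀ i, (σ (i, 0)).1 = (σ (i, 1)).1
  · obtain ⟨π, τ, rfl⟩ : ∃ (π : Equiv.Perm (Fin n)) (τ : Fin n → Equiv.Perm (Fin 2)),
        σ = (Equiv.prodCongrLeft fun _ => π) * Equiv.prodCongrRight τ := by
      refine exists_eq_prodCongrLeft_mul_prodCongrRight fun i k l => ?_
      fin_cases k <;> fin_cases l <;> simp [hσ]
    have hsign : Equiv.Perm.sign ((Equiv.prodCongrLeft fun _ : Fin 2 => π) *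
        Equiv.prodCongrRight τ) = ∏ i, Equiv.Perm.sign (τ i) := by
      simp [Equiv.Perm.sign_prodCongrLeft, Equiv.Perm.sign_prodCongrRight]
    have hprod := fun i => hα.apply_realBasis_perm hb₁ (π i) (τ i)
    simp only [Equiv.Perm.mul_apply, Equiv.prodCongrRight_apply, Equiv.prodCongrLeft_apply, hprod,
      hsign]
    push_cast
    exact mul_self_nonneg _
  · push Not at hσ
    obtain ⟨i, hi⟩ := hσ
    rw [Finset.prod_eq_zero (Finset.mem_univ i)
      (hα.apply_realBasis_of_fst_ne hb₀ hb₁ hi), mul_zero]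

lemma wedgePow_realBasis_pos (hα : IsPositiveOneOne α) : 0 < wedgePow α n (realBasis b) := by
  refine mul_pos (by positivity) (Finset.sum_pos'
    (fun σ _ => hα.sign_mul_prod_nonneg hb₀ hb₁ σ) ⟨1, Finset.mem_univ _, ?_⟩)
  simp [realBasis_zero, realBasis_one, hb₁]

end UnitaryBasis

lemma topCoeff_ne_zero [FiniteDimensional ℂ E] (hα : IsPositiveOneOne α) : topCoeff α ≠ 0 := by
  obtain ⟨b, hb₀, hb₁⟩ := hα.exists_unitary_basis
  exact topCoeff_ne_zero_of_basis b (hα.wedgePow_realBasis_pos hb₀ hb₁).ne'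

end IsPositiveOneOne

end TopPower

/-! ### Coordinate expressions -/

section Charts

variable {E : Type*} [NormedAddCommGroup E] [NormedSpace ℂ E]
  {F : Type*} [NormedAddCommGroup F] [NormedSpace ℝ F]
  {H : Type*} [NormedAddCommGroup H] [NormedSpace ℝ H]
  {M : Type*} [TopologicalSpace M] [ChartedSpace E M]

lemma mfderiv_eq_fderiv_chartAt {N N' : Type*} [TopologicalSpace N] [ChartedSpace F N]
    [TopologicalSpace N'] [ChartedSpace H N'] {f : N → N'} {p : N}
    (hf : MDifferentiableAt 𝓘(ℝ, F) 𝓘(ℝ, H) f p) :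
    (mfderiv 𝓘(ℝ, F) 𝓘(ℝ, H) f p : F →L[ℝ] H) =
      fderiv ℝ (chartAt H (f p) ∘ f ∘ (chartAt F p).symm) (chartAt F p p) := by
  refine hf.mfderiv.trans ?_
  simp only [writtenInExtChartAt, extChartAt, mfld_simps, fderivWithin_univ]
  rfl

lemma IsSmooth.add {f g : M → ℝ} (hf : IsSmooth E f) (hg : IsSmooth E g) : IsSmooth E (f + g) :=
  ContMDiff.add hf hg

lemma IsSmooth.sub {f g : M → ℝ} (hf : IsSmooth E f) (hg : IsSmooth E g) : IsSmooth E (f - g) :=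
  ContMDiff.sub hf hg

lemma IsSmooth.const_smul {f : M → ℝ} (c : ℝ) (hf : IsSmooth E f) : IsSmooth E (c • f) :=
  ContMDiff.mul (contMDiff_const (c := c)) hf

lemma isSmooth_const (c : ℝ) : IsSmooth E (fun _ : M => c) :=
  contMDiff_const

lemma IsSmooth.mdifferentiableAt {f : M → ℝ} (hf : IsSmooth E f) (p : M) :
    MDifferentiableAt 𝓘(ℝ, E) 𝓘(ℝ, ℝ) f p :=
  ContMDiff.mdifferentiable hf (by simp) p

variable [IsManifold 𝓘(ℂ, E) ω M]

lemma contDiffAt_transition {e e' : OpenPartialHomeomorph M E} (he : e ∈ atlas E M)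
    (he' : e' ∈ atlas E M) {x : E} (hx : x ∈ e.target) (hx' : e.symm x ∈ e'.source) :
    ContDiffAt ℂ ω (e' ∘ e.symm) x := by
  have hgroupoid := StructureGroupoid.compatible (contDiffGroupoid ω 𝓘(ℂ, E)) he he'
  have htrans : ContDiffOn ℂ ω (e' ∘ e.symm) (e.symm ≫ₕ e').source := by
    simpa [contDiffPregroupoid] using (mem_groupoid_of_pregroupoid.1 hgroupoid).1
  exact htrans.contDiffAt ((e.symm ≫ₕ e').open_source.mem_nhds (by simp [hx, hx']))

variable (E M) in
lemma isManifold_real : IsManifold 𝓘(ℝ, E) ∞ M := by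
  refine isManifold_of_contDiffOn _ _ _ fun e e' he he' => ?_
  simp only [modelWithCornersSelf_coe, modelWithCornersSelf_coe_symm, Function.comp_id,
    Set.range_id, Function.id_comp, Set.inter_univ, Set.preimage_id]
  intro x hx
  have hx : x ∈ e.target ∧ e.symm x ∈ e'.source := by simpa using hx
  exact ((contDiffAt_transition he he' hx.1 hx.2).restrict_scalars ℝ |>.of_le
    le_top).contDiffWithinAt

variable (E M) in
lemma isManifold_real_one : IsManifold 𝓘(ℝ, E) 1 M :=
  have := isManifold_real E M
  IsManifold.of_le (n := ∞) (by simp)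

lemma isSmooth_of_contDiffAt {f : M → ℝ}
    (hf : ∀ p, ContDiffAt ℝ ∞ (f ∘ (chartAt E p).symm) (chartAt E p p)) : IsSmooth E f := by
  have := isManifold_real E M
  intro p
  have hchart : ContMDiffAt 𝓘(ℝ, E) 𝓘(ℝ, E) ∞ (chartAt E p) p :=
    contMDiffAt_of_mem_maximalAtlas (IsManifold.chart_mem_maximalAtlas p) (mem_chart_source E p)
  refine ((hf p).contMDiffAt.comp p hchart).congr_of_eventuallyEq ?_
  filter_upwards [(chartAt E p).eventually_left_inverse (mem_chart_source E p)] with q hq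
  simp [hq]

section Atlas

variable {e : OpenPartialHomeomorph M E} (he : e ∈ atlas E M) {x : E} (hx : x ∈ e.target)
include he hx

lemma IsSmooth.contDiffAt {f : M → ℝ} (hf : IsSmooth E f) : ContDiffAt ℝ ∞ (f ∘ e.symm) x := by
  have := isManifold_real E M
  have hsymm := contMDiffOn_symm_of_mem_maximalAtlas (I := 𝓘(ℝ, E)) (n := ∞)
    (IsManifold.subset_maximalAtlas he)
  have hf' : ContDiffOn ℝ ∞ (f ∘ e.symm) e.target :=
    contMDiffOn_iff_contDiffOn.1 (ContMDiff.comp_contMDiffOn hf hsymm)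
  exact hf'.contDiffAt (e.open_target.mem_nhds hx)

omit [IsManifold 𝓘(ℂ, E) ω M] in
lemma IsRealHolomorphic.contDiffAt {X : VectorField E M} (hX : IsRealHolomorphic X) :
    ContDiffAt ℝ ∞ (chartField e X) x :=
  (hX.smooth e he).contDiffAt (e.open_target.mem_nhds hx)

omit [IsManifold 𝓘(ℂ, E) ω M] in
lemma IsRealHolomorphic.eventually_differentiableAt {X : VectorField E M}
    (hX : IsRealHolomorphic X) : ∀ᶠ y in 𝓝 x, DifferentiableAt ℂ (chartField e X) y :=
  (hX.holomorphic e he).eventually_differentiableAt (e.open_target.mem_nhds hx)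

lemma mfderiv_chart_symm :
    (mfderiv 𝓘(ℝ, E) 𝓘(ℝ, E) e.symm x : E →L[ℝ] E) =
      fderiv ℝ (chartAt E (e.symm x) ∘ e.symm) x := by
  have := isManifold_real_one E M
  exact mfderiv_eq_fderiv_chartAt (mdifferentiableAt_atlas_symm he hx)

lemma chartForm_eq_bilinearComp_fderiv (Ω : TwoForm E M) :
    chartForm e Ω x = (Ω (e.symm x)).bilinearComp (fderiv ℝ (chartAt E (e.symm x) ∘ e.symm) x)
      (fderiv ℝ (chartAt E (e.symm x) ∘ e.symm) x) :=
  congrArg (fun A : E →L[ℝ] E => (Ω (e.symm x)).bilinearComp A A) (mfderiv_chart_symm he hx)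

lemma det_fderiv_chartAt_comp_symm_ne_zero :
    LinearMap.det (fderiv ℝ (chartAt E (e.symm x) ∘ e.symm) x : E →ₗ[ℝ] E) ≠ 0 := by
  have := isManifold_real_one E M
  obtain ⟨A, hA⟩ : ∃ A : E →L[ℝ] E,
      A.comp (fderiv ℝ (chartAt E (e.symm x) ∘ e.symm) x) = .id ℝ E := by
    refine ⟨mfderiv 𝓘(ℝ, E) 𝓘(ℝ, E) e (e.symm x), ?_⟩
    rw [← mfderiv_chart_symm he hx]
    exact (mdifferentiable_of_mem_atlas he).comp_symm_deriv hx
  have hdet := congrArg (fun B : E →L[ℝ] E => LinearMap.det (B : E →ₗ[ℝ] E)) hA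
  simp only [ContinuousLinearMap.toLinearMap_comp, LinearMap.det_comp, ContinuousLinearMap.coe_id,
    LinearMap.det_id] at hdet
  exact right_ne_zero_of_mul (hdet.trans_ne one_ne_zero)

lemma chartField_rotate (X : VectorField E M) :
    chartField e (rotate X) x = Complex.I • chartField e X x := by
  have := isManifold_real_one E M
  have hs := e.map_target hx
  have hmfderiv : (mfderiv 𝓘(ℝ, E) 𝓘(ℝ, E) e (e.symm x) : E →L[ℝ] E) =
      fderiv ℝ (e ∘ (chartAt E (e.symm x)).symm) (chartAt E (e.symm x) (e.symm x)) :=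
    mfderiv_eq_fderiv_chartAt (mdifferentiableAt_atlas he hs)
  have htrans := contDiffAt_transition (chart_mem_atlas E (e.symm x)) he
    (mem_chart_target E (e.symm x)) (by rwa [(chartAt E _).left_inv (mem_chart_source E _)])
  rw [chartField, chartField, hmfderiv]
  exact fderiv_I_smul (htrans.differentiableAt (by simp)) _

lemma dirDeriv_eq_fderiv {f : M → ℝ} (hf : IsSmooth E f) (X : VectorField E M) :
    dirDeriv X f (e.symm x) = fderiv ℝ (f ∘ e.symm) x (chartField e X x) := by
  have := isManifold_real_one E M
  have hs := e.map_target hx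
  have hfe : f =ᶠ[𝓝 (e.symm x)] (f ∘ e.symm) ∘ e := by
    filter_upwards [e.eventually_left_inverse hs] with q hq
    simp [hq]
  have hd : DifferentiableAt ℝ (f ∘ e.symm) (e (e.symm x)) := by
    rw [e.right_inv hx]
    exact (hf.contDiffAt he hx).differentiableAt (by simp)
  rw [dirDeriv, hfe.mfderiv_eq, mfderiv_comp (e.symm x) hd.mdifferentiableAt
    (mdifferentiableAt_atlas he hs), mfderiv_eq_fderiv, e.right_inv hx]
  rfl

lemma dirDeriv_comp_symm_eventuallyEq {f : M → ℝ} (hf : IsSmooth E f) (X : VectorField E M) :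
    dirDeriv X f ∘ e.symm =ᶠ[𝓝 x] fun y => fderiv ℝ (f ∘ e.symm) y (chartField e X y) := by
  filter_upwards [e.open_target.mem_nhds hx] with y hy
  exact dirDeriv_eq_fderiv he hy hf X

lemma chartForm_ddbar {f : M → ℝ} (hf : IsSmooth E f) :
    chartForm e (ddbar f) x = ddbarFlat (f ∘ e.symm) x := by
  set c := chartAt E (e.symm x)
  have hsrc : e.symm x ∈ c.source := mem_chart_source E _
  have hcm : c ∈ atlas E M := chart_mem_atlas E _
  have htrans := contDiffAt_transition he hcm hx hsrc
  have hcongr : f ∘ e.symm =ᶠ[𝓝 x] (f ∘ c.symm) ∘ (c ∘ e.symm) := by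
    filter_upwards [(e.continuousAt_symm hx).eventually (c.eventually_left_inverse hsrc)] with y hy
    simp [hy]
  have hcomp := ddbarFlat_comp (f := f ∘ c.symm) (g := c ∘ e.symm)
    ((hf.contDiffAt hcm (c.map_source hsrc)).of_le ENat.LEInfty.out)
    ((htrans.restrict_scalars ℝ).of_le le_top)
    ((htrans.of_le le_top).eventually (n := 1) (by simp) |>.mono
      fun y hy => hy.differentiableAt (by simp))
  rw [ddbarFlat_congr hcongr, hcomp, chartForm_eq_bilinearComp_fderiv he hx]
  rfl

lemma chartForm_add_ddbar_eventuallyEq (Ω : TwoForm E M) {f : M → ℝ} (hf : IsSmooth E f) :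
    chartForm e (Ω + ddbar f) =ᶠ[𝓝 x] chartForm e Ω + ddbarFlat (f ∘ e.symm) := by
  filter_upwards [e.open_target.mem_nhds hx] with y hy
  rw [Pi.add_apply, ← chartForm_ddbar he hy hf]
  rfl

lemma topCoeff_chartForm_eq_zero_iff [FiniteDimensional ℂ E] (Ω : TwoForm E M) :
    topCoeff (chartForm e Ω x) = 0 ↔ topCoeff (Ω (e.symm x)) = 0 := by
  rw [chartForm_eq_bilinearComp_fderiv he hx, topCoeff_bilinearComp,
    mul_eq_zero_iff_left (det_fderiv_chartAt_comp_symm_ne_zero he hx)]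

lemma volumeRatio_eq_chartForm [FiniteDimensional ℂ E] (Ω' Ω : TwoForm E M) :
    volumeRatio Ω' Ω (e.symm x) =
      topCoeff (chartForm e Ω' x) / topCoeff (chartForm e Ω x) := by
  rw [chartForm_eq_bilinearComp_fderiv he hx, chartForm_eq_bilinearComp_fderiv he hx,
    topCoeff_bilinearComp, topCoeff_bilinearComp,
    mul_div_mul_left _ _ (det_fderiv_chartAt_comp_symm_ne_zero he hx), volumeRatio]

end Atlas

end Charts

/-! ### Differential operators on the manifold -/

section Calculus

variable {E : Type*} [NormedAddCommGroup E] [NormedSpace ℂ E]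
  {M : Type*} [TopologicalSpace M] [ChartedSpace E M]

lemma ddbar_const (c : ℝ) : ddbar (E := E) (fun _ : M => c) = 0 := by
  ext p u v
  simp [ddbar, ddbarFlat_apply, Function.comp_def, fderiv_fun_const]

lemma dirDeriv_add {f g : M → ℝ} (hf : IsSmooth E f) (hg : IsSmooth E g) (X : VectorField E M) :
    dirDeriv X (f + g) = dirDeriv X f + dirDeriv X g :=
  funext fun p => DFunLike.congr_fun
    (mfderiv_add (hf.mdifferentiableAt p) (hg.mdifferentiableAt p)) (X p)

lemma dirDeriv_sub {f g : M → ℝ} (hf : IsSmooth E f) (hg : IsSmooth E g) (X : VectorField E M) :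
    dirDeriv X (f - g) = dirDeriv X f - dirDeriv X g :=
  funext fun p => DFunLike.congr_fun
    (mfderiv_sub (hf.mdifferentiableAt p) (hg.mdifferentiableAt p)) (X p)

lemma dirDeriv_const_smul (c : ℝ) {f : M → ℝ} (hf : IsSmooth E f) (X : VectorField E M) :
    dirDeriv X (c • f) = c • dirDeriv X f :=
  funext fun p => DFunLike.congr_fun (const_smul_mfderiv (hf.mdifferentiableAt p) c) (X p)

lemma dirDeriv_const (c : ℝ) (X : VectorField E M) : dirDeriv X (fun _ : M => c) = 0 :=
  funext fun p => DFunLike.congr_fun mfderiv_const (X p)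

variable [IsManifold 𝓘(ℂ, E) ω M]

lemma ddbar_add {f g : M → ℝ} (hf : IsSmooth E f) (hg : IsSmooth E g) :
    ddbar (E := E) (f + g) = ddbar f + ddbar g := by
  ext1 p
  have he := chart_mem_atlas E p
  have hx := mem_chart_target E p
  exact ddbarFlat_add ((hf.contDiffAt he hx).of_le ENat.LEInfty.out)
    ((hg.contDiffAt he hx).of_le ENat.LEInfty.out)

lemma ddbar_sub {f g : M → ℝ} (hf : IsSmooth E f) (hg : IsSmooth E g) :
    ddbar (E := E) (f - g) = ddbar f - ddbar g := by
  ext1 p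
  have he := chart_mem_atlas E p
  have hx := mem_chart_target E p
  exact ddbarFlat_sub ((hf.contDiffAt he hx).of_le ENat.LEInfty.out)
    ((hg.contDiffAt he hx).of_le ENat.LEInfty.out)

lemma ddbar_sub_of_ddbar_eq_zero {f h : M → ℝ} (hf : IsSmooth E f) (hh : IsSmooth E h)
    (hdd : ddbar (E := E) h = 0) : ddbar (E := E) (f - h) = ddbar f := by
  rw [ddbar_sub hf hh, hdd]
  module

lemma ddbar_const_smul (c : ℝ) {f : M → ℝ} (hf : IsSmooth E f) :
    ddbar (E := E) (c • f) = c • ddbar f := by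
  ext1 p
  exact ddbarFlat_const_smul c ((hf.contDiffAt (chart_mem_atlas E p)
    (mem_chart_target E p)).of_le ENat.LEInfty.out)

lemma IsSmooth.exists_eq_const_of_mfderiv_eq_zero [PreconnectedSpace M] {f : M → ℝ}
    (hf : IsSmooth E f) (h : ∀ p, mfderiv 𝓘(ℝ, E) 𝓘(ℝ, ℝ) f p = 0) :
    ∃ c, f = Function.const M c := by
  have := isManifold_real_one E M
  refine IsLocallyConstant.exists_eq_const fun s => isOpen_iff_mem_nhds.2 fun p hp => ?_
  set e := chartAt E p
  have he : e ∈ atlas E M := chart_mem_atlas E p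
  have hdiff : DifferentiableOn ℝ (f ∘ e.symm) e.target := fun x hx =>
    ((hf.contDiffAt he hx).differentiableAt (by simp)).differentiableWithinAt
  have hzero : Set.EqOn (fderiv ℝ (f ∘ e.symm)) 0 e.target := fun x hx => by
    rw [← mfderiv_eq_fderiv, mfderiv_comp x (hf.mdifferentiableAt _)
      (mdifferentiableAt_atlas_symm he hx), h]
    exact ContinuousLinearMap.zero_comp _
  filter_upwards [(e.isOpen_inter_preimage
    (e.open_target.isOpen_inter_preimage_of_fderiv_eq_zero hdiff hzero s)).mem_nhds
      (show p ∈ _ by simpa [e] using hp)] with q hq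
  simpa [hq.1] using hq.2.2

lemma IsRealHolomorphic.rotate {X : VectorField E M} (hX : IsRealHolomorphic X) :
    IsRealHolomorphic (rotate X) where
  smooth e he := ((hX.smooth e he).const_smul Complex.I).congr fun _ hx => chartField_rotate he hx X
  holomorphic e he :=
    ((hX.holomorphic e he).const_smul Complex.I).congr fun _ hx => chartField_rotate he hx X

section HolomorphicField

variable {X : VectorField E M} (hX : IsRealHolomorphic X) {f : M → ℝ} (hf : IsSmooth E f)
include hX hf

lemma isSmooth_dirDeriv : IsSmooth E (dirDeriv X f) := by
  refine isSmooth_of_contDiffAt fun p => ?_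
  have he := chart_mem_atlas E p
  have hx := mem_chart_target E p
  have hfderiv : ContDiffAt ℝ ∞ (fderiv ℝ (f ∘ (chartAt E p).symm)) (chartAt E p p) :=
    (hf.contDiffAt he hx).fderiv_right le_rfl
  exact (hfderiv.clm_apply (hX.contDiffAt he hx)).congr_of_eventuallyEq
    (dirDeriv_comp_symm_eventuallyEq he hx hf X)

lemma lieDeriv_add_ddbar {Ω : TwoForm E M}
    (hΩ : ∀ p, DifferentiableAt ℝ (chartForm (chartAt E p) Ω) (chartAt E p p)) :
    lieDeriv X (Ω + ddbar f) = lieDeriv X Ω + ddbar (dirDeriv X f) := by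
  ext1 p
  have he := chart_mem_atlas E p
  have hx := mem_chart_target E p
  have hfp := hf.contDiffAt he hx
  rw [Pi.add_apply, lieDeriv, lieDeriv,
    lieFlat_congr .rfl (chartForm_add_ddbar_eventuallyEq he hx Ω hf),
    lieFlat_add _ (hΩ p) ((contDiffAt_ddbarFlat hfp).differentiableAt (by simp)),
    lieFlat_ddbarFlat (hfp.of_le ENat.LEInfty.out)
      ((hX.contDiffAt he hx).of_le ENat.LEInfty.out) (hX.eventually_differentiableAt he hx),
    ddbar, ddbarFlat_congr (dirDeriv_comp_symm_eventuallyEq he hx hf X)]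

omit hX in
lemma eventually_fderiv_I_smul_chartField (hJ : ∀ p, dirDeriv (rotate X) f p = 0)
    {e : OpenPartialHomeomorph M E} (he : e ∈ atlas E M) {x : E} (hx : x ∈ e.target) :
    ∀ᶠ y in 𝓝 x, fderiv ℝ (f ∘ e.symm) y (Complex.I • chartField e X y) = 0 := by
  filter_upwards [e.open_target.mem_nhds hx] with y hy
  rw [← chartField_rotate he hy, ← dirDeriv_eq_fderiv he hy hf, hJ]

lemma dirDeriv_rotate_dirDeriv (hJ : ∀ p, dirDeriv (rotate X) f p = 0) (p : M) :
    dirDeriv (rotate X) (dirDeriv X f) p = 0 := by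
  have he := chart_mem_atlas E p
  have hx := mem_chart_target E p
  have h := dirDeriv_eq_fderiv he hx (isSmooth_dirDeriv hX hf) (rotate X)
  rw [(chartAt E p).left_inv (mem_chart_source E p)] at h
  rw [h, chartField_rotate he hx, (dirDeriv_comp_symm_eventuallyEq he hx hf X).fderiv_eq]
  exact fderiv_apply_field_I_smul_field ((hf.contDiffAt he hx).of_le ENat.LEInfty.out)
    (hX.eventually_differentiableAt he hx).self_of_nhds
    (eventually_fderiv_I_smul_chartField hf hJ he hx)

lemma exists_dirDeriv_eq_const [PreconnectedSpace M] (hJ : ∀ p, dirDeriv (rotate X) f p = 0)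
    (hdd : ddbar (E := E) f = 0) : ∃ c, dirDeriv X f = Function.const M c := by
  have hs := isSmooth_dirDeriv hX hf
  refine hs.exists_eq_const_of_mfderiv_eq_zero fun p => ?_
  have he := chart_mem_atlas E p
  have hx := mem_chart_target E p
  refine (mfderiv_eq_fderiv_chartAt (hs.mdifferentiableAt p)).trans ?_
  refine (dirDeriv_comp_symm_eventuallyEq he hx hf X).fderiv_eq.trans ?_
  exact fderiv_apply_field_eq_zero ((hf.contDiffAt he hx).of_le ENat.LEInfty.out)
    (hX.eventually_differentiableAt he hx).self_of_nhds
    (eventually_fderiv_I_smul_chartField hf hJ he hx) (congrFun hdd p)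

end HolomorphicField

section Volume

variable [FiniteDimensional ℂ E]

/-- Smooth 2-forms whose top power vanishes nowhere. -/
structure IsNondegenerate (Ω : TwoForm E M) : Prop where
  smooth : ∀ e ∈ atlas E M, ContDiffOn ℝ ∞ (chartForm e Ω) e.target
  topCoeff_ne_zero : ∀ p, topCoeff (Ω p) ≠ 0

section Chart

variable {Ω : TwoForm E M} (hΩ : IsNondegenerate Ω) {e : OpenPartialHomeomorph M E}
  (he : e ∈ atlas E M) {x : E} (hx : x ∈ e.target)
include hΩ he hx

omit [IsManifold 𝓘(ℂ, E) ω M] in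
lemma IsNondegenerate.contDiffAt_chartForm : ContDiffAt ℝ ∞ (chartForm e Ω) x :=
  (hΩ.smooth e he).contDiffAt (e.open_target.mem_nhds hx)

lemma IsNondegenerate.topCoeff_chartForm_ne_zero : topCoeff (chartForm e Ω x) ≠ 0 :=
  (topCoeff_chartForm_eq_zero_iff he hx Ω).not.2 (hΩ.topCoeff_ne_zero _)

lemma contDiffAt_log_topCoeff_chartForm :
    ContDiffAt ℝ ∞ (fun y => Real.log (topCoeff (chartForm e Ω y))) x :=
  (contDiff_topCoeff.contDiffAt.comp x (hΩ.contDiffAt_chartForm he hx)).log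
    (hΩ.topCoeff_chartForm_ne_zero he hx)

end Chart

omit [IsManifold 𝓘(ℂ, E) ω M] in
lemma IsNondegenerate.differentiableAt_chartForm {Ω : TwoForm E M} (hΩ : IsNondegenerate Ω)
    (p : M) : DifferentiableAt ℝ (chartForm (chartAt E p) Ω) (chartAt E p p) :=
  (hΩ.contDiffAt_chartForm (chart_mem_atlas E p) (mem_chart_target E p)).differentiableAt (by simp)

lemma fderiv_log_topCoeff_chartForm {Ω : TwoForm E M} (hΩ : IsNondegenerate Ω)
    {Y : VectorField E M} {p : M} (hY : lieDeriv Y Ω p = 0) :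
    fderiv ℝ (fun y => Real.log (topCoeff (chartForm (chartAt E p) Ω y))) (chartAt E p p)
        (chartField (chartAt E p) Y (chartAt E p p)) =
      -LinearMap.trace ℝ E (fderiv ℝ (chartField (chartAt E p) Y) (chartAt E p p)) := by
  have he := chart_mem_atlas E p
  have hx := mem_chart_target E p
  have hdiff : DifferentiableAt ℝ (fun y => topCoeff (chartForm (chartAt E p) Ω y))
      (chartAt E p p) :=
    (contDiff_topCoeff.contDiffAt.comp _ (hΩ.contDiffAt_chartForm he hx)).differentiableAt (by simp)
  have hne := hΩ.topCoeff_chartForm_ne_zero he hx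
  rw [fderiv.log hdiff hne, smul_apply, smul_eq_mul,
    fderiv_topCoeff_comp_apply (hΩ.differentiableAt_chartForm p) hY]
  field_simp

section Ratio

variable {Ω' Ω : TwoForm E M} (h' : IsNondegenerate Ω') (h : IsNondegenerate Ω)
include h' h

lemma log_volumeRatio_comp_symm_eventuallyEq {e : OpenPartialHomeomorph M E} (he : e ∈ atlas E M)
    {x : E} (hx : x ∈ e.target) :
    (fun p => Real.log (volumeRatio Ω' Ω p)) ∘ e.symm =ᶠ[𝓝 x]
      (fun y => Real.log (topCoeff (chartForm e Ω' y))) -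
        fun y => Real.log (topCoeff (chartForm e Ω y)) := by
  filter_upwards [e.open_target.mem_nhds hx] with y hy
  rw [Function.comp_apply, volumeRatio_eq_chartForm he hy, Pi.sub_apply,
    Real.log_div (h'.topCoeff_chartForm_ne_zero he hy) (h.topCoeff_chartForm_ne_zero he hy)]

lemma isSmooth_log_volumeRatio : IsSmooth E fun p => Real.log (volumeRatio Ω' Ω p) := by
  refine isSmooth_of_contDiffAt fun p => ?_
  have he := chart_mem_atlas E p
  have hx := mem_chart_target E p
  exact ((contDiffAt_log_topCoeff_chartForm h' he hx).sub
    (contDiffAt_log_topCoeff_chartForm h he hx)).congr_of_eventuallyEq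
      (log_volumeRatio_comp_symm_eventuallyEq h' h he hx)

lemma ddbar_log_volumeRatio :
    ddbar (fun p => Real.log (volumeRatio Ω' Ω p)) = ricciForm Ω - ricciForm Ω' := by
  ext1 p
  have he := chart_mem_atlas E p
  have hx := mem_chart_target E p
  rw [ddbar, ddbarFlat_congr (log_volumeRatio_comp_symm_eventuallyEq h' h he hx), ddbarFlat_sub
    ((contDiffAt_log_topCoeff_chartForm h' he hx).of_le ENat.LEInfty.out)
    ((contDiffAt_log_topCoeff_chartForm h he hx).of_le ENat.LEInfty.out)]
  ext u v
  exact (neg_sub_neg _ _).symm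

lemma dirDeriv_log_volumeRatio_eq_zero {Y : VectorField E M} {p : M} (hY' : lieDeriv Y Ω' p = 0)
    (hY : lieDeriv Y Ω p = 0) : dirDeriv Y (fun q => Real.log (volumeRatio Ω' Ω q)) p = 0 := by
  have he := chart_mem_atlas E p
  have hx := mem_chart_target E p
  have hdir := dirDeriv_eq_fderiv he hx (isSmooth_log_volumeRatio h' h) Y
  rw [(chartAt E p).left_inv (mem_chart_source E p)] at hdir
  rw [hdir, (log_volumeRatio_comp_symm_eventuallyEq h' h he hx).fderiv_eq,
    fderiv_sub ((contDiffAt_log_topCoeff_chartForm h' he hx).differentiableAt (by simp))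
      ((contDiffAt_log_topCoeff_chartForm h he hx).differentiableAt (by simp)),
    sub_apply, fderiv_log_topCoeff_chartForm h' hY',
    fderiv_log_topCoeff_chartForm h hY, sub_self]

end Ratio

end Volume

end Calculus

section Hermitian

variable {E : Type*} [NormedAddCommGroup E] [NormedSpace ℂ E]
  {M : Type*} [TopologicalSpace M] [ChartedSpace E M]

/-- Fundamental forms of Hermitian metrics: smooth positive real (1,1)-forms, not necessarily
closed. -/
structure IsHermitianForm (Ω : TwoForm E M) : Prop where
  smooth : ∀ e ∈ atlas E M, ContDiffOn ℝ ∞ (chartForm e Ω) e.target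
  isPositiveOneOne : ∀ p, IsPositiveOneOne (Ω p)

lemma IsKahlerForm.isHermitianForm {Ω : TwoForm E M} (hΩ : IsKahlerForm Ω) : IsHermitianForm Ω :=
  ⟨hΩ.smooth, fun p => ⟨hΩ.alternating p, hΩ.typeOneOne p, hΩ.positive p⟩⟩

lemma IsHermitianForm.isNondegenerate [FiniteDimensional ℂ E] {Ω : TwoForm E M}
    (hΩ : IsHermitianForm Ω) : IsNondegenerate Ω :=
  ⟨hΩ.smooth, fun p => (hΩ.isPositiveOneOne p).topCoeff_ne_zero⟩

lemma IsHermitianForm.add_ddbar [IsManifold 𝓘(ℂ, E) ω M] {Ω : TwoForm E M}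
    (hΩ : IsHermitianForm Ω) {f : M → ℝ} (hf : IsSmooth E f) (hpos : IsPositive (Ω + ddbar f)) :
    IsHermitianForm (Ω + ddbar f) where
  smooth e he x hx := by
    have hΩx := (hΩ.smooth e he).contDiffAt (e.open_target.mem_nhds hx)
    exact ((hΩx.add (contDiffAt_ddbarFlat (hf.contDiffAt he hx))).congr_of_eventuallyEq
      (chartForm_add_ddbar_eventuallyEq he hx Ω hf)).contDiffWithinAt
  isPositiveOneOne p := by
    have hfp := hf.contDiffAt (chart_mem_atlas E p) (mem_chart_target E p)
    refine ⟨fun u => ?_, fun u v => ?_, hpos p⟩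
    · rw [Pi.add_apply, add_apply, add_apply, (hΩ.isPositiveOneOne p).alternating, ddbar,
        ddbarFlat_eq_oneOnePart, oneOnePart_self (fderiv_fderiv_comm (hfp.of_le ENat.LEInfty.out)),
        add_zero]
    · simp only [Pi.add_apply, add_apply, (hΩ.isPositiveOneOne p).typeOneOne, ddbar,
        ddbarFlat_eq_oneOnePart, oneOnePart_I_smul_I_smul]

end Hermitian

/-! ### Invariance under flows -/

section Flow

variable {E : Type*} [NormedAddCommGroup E] [NormedSpace ℂ E]
  {M : Type*} [TopologicalSpace M] [ChartedSpace E M]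

/-- The expression in a chart of a one-parameter family of maps `θ`, as a map of the parameter and
the point. -/
def chartFlow (e : OpenPartialHomeomorph M E) (θ : ℝ → M → M) (q : ℝ × E) : E :=
  e (θ q.1 (e.symm q.2))

section Smooth

variable {θ : ℝ → M → M}
  (hθ : ContMDiff (𝓘(ℝ, ℝ).prod 𝓘(ℝ, E)) 𝓘(ℝ, E) ∞ fun q : ℝ × M => θ q.1 q.2)
include hθ

lemma contMDiff_flow_apply (p : M) : ContMDiff 𝓘(ℝ, ℝ) 𝓘(ℝ, E) ∞ fun s => θ s p :=
  hθ.comp (contMDiff_id.prodMk contMDiff_const)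

lemma contMDiff_flow (s : ℝ) : ContMDiff 𝓘(ℝ, E) 𝓘(ℝ, E) ∞ (θ s) :=
  hθ.comp (contMDiff_const.prodMk contMDiff_id)

end Smooth

variable [IsManifold 𝓘(ℂ, E) ω M]

lemma mfderiv_chart_symm_comp_fderiv {e e' : OpenPartialHomeomorph M E} (he : e ∈ atlas E M)
    (he' : e' ∈ atlas E M) {x : E} (hx : x ∈ e.target) {τ : M → M}
    (hτ : MDifferentiableAt 𝓘(ℝ, E) 𝓘(ℝ, E) τ (e.symm x)) (hx' : τ (e.symm x) ∈ e'.source) :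
    (mfderiv 𝓘(ℝ, E) 𝓘(ℝ, E) e'.symm (e' (τ (e.symm x))) : E →L[ℝ] E).comp
        (fderiv ℝ (F := E) (e' ∘ τ ∘ e.symm) x) =
      (mfderiv 𝓘(ℝ, E) 𝓘(ℝ, E) τ (e.symm x) : E →L[ℝ] E).comp
        (mfderiv 𝓘(ℝ, E) 𝓘(ℝ, E) e.symm x : E →L[ℝ] E) := by
  have := isManifold_real_one E M
  have hsymm := mdifferentiableAt_atlas_symm (I := 𝓘(ℝ, E)) he hx
  have hτe : MDifferentiableAt 𝓘(ℝ, E) 𝓘(ℝ, E) (τ ∘ e.symm) x := hτ.comp x hsymm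
  have he'τ : MDifferentiableAt 𝓘(ℝ, E) 𝓘(ℝ, E) (e' ∘ τ ∘ e.symm) x :=
    (mdifferentiableAt_atlas he' hx').comp x hτe
  have hcancel : e'.symm ∘ (e' ∘ τ ∘ e.symm) =ᶠ[𝓝 x] τ ∘ e.symm := by
    filter_upwards [hτe.continuousAt.preimage_mem_nhds (e'.open_source.mem_nhds hx')] with y hy
      using e'.left_inv hy
  rw [← mfderiv_eq_fderiv]
  refine (mfderiv_comp x (mdifferentiableAt_atlas_symm he' (e'.map_source hx')) he'τ).symm.trans ?_
  exact hcancel.mfderiv_eq.trans (mfderiv_comp x hτ hsymm)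

section ChartFlow

variable {θ : ℝ → M → M}
  (hθ : ContMDiff (𝓘(ℝ, ℝ).prod 𝓘(ℝ, E)) 𝓘(ℝ, E) ∞ fun q : ℝ × M => θ q.1 q.2)
  (h0 : ∀ p, θ 0 p = p) {e : OpenPartialHomeomorph M E} (he : e ∈ atlas E M) {x : E}
  (hx : x ∈ e.target)
include hθ h0 he hx

lemma contDiffAt_chartFlow : ContDiffAt ℝ ∞ (chartFlow e θ) (0, x) := by
  have := isManifold_real E M
  have hmax : e ∈ IsManifold.maximalAtlas 𝓘(ℝ, E) ∞ M := IsManifold.subset_maximalAtlas he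
  have hsymm : ContMDiffAt 𝓘(ℝ, E) 𝓘(ℝ, E) ∞ e.symm x :=
    (contMDiffOn_symm_of_mem_maximalAtlas hmax).contMDiffAt (e.open_target.mem_nhds hx)
  have hchart : ContMDiffAt 𝓘(ℝ, E) 𝓘(ℝ, E) ∞ e (θ 0 (e.symm x)) := by
    rw [h0]
    exact contMDiffAt_of_mem_maximalAtlas hmax (e.map_target hx)
  have hprod : ContMDiffAt 𝓘(ℝ, ℝ × E) (𝓘(ℝ, ℝ).prod 𝓘(ℝ, E)) ∞
      (fun q : ℝ × E => (q.1, e.symm q.2)) (0, x) :=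
    contDiff_fst.contMDiff.contMDiffAt.prodMk
      (hsymm.comp (0, x) contDiff_snd.contMDiff.contMDiffAt)
  have hflow : ContMDiffAt 𝓘(ℝ, ℝ × E) 𝓘(ℝ, E) ∞ (fun q : ℝ × E => θ q.1 (e.symm q.2)) (0, x) :=
    (hθ (0, e.symm x)).comp (0, x) hprod
  exact (hchart.comp (0, x) hflow).contDiffAt

lemma chartField_eq_fderiv_chartFlow {Y : VectorField E M}
    (hY : ∀ p, Y p = (mfderiv 𝓘(ℝ, ℝ) 𝓘(ℝ, E) (fun s => θ s p) 0 : ℝ →L[ℝ] E) 1) :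
    chartField e Y x = fderiv ℝ (chartFlow e θ) (0, x) (1, 0) := by
  have := isManifold_real_one E M
  have hline : HasDerivAt (fun s => chartFlow e θ (s, x))
      (fderiv ℝ (chartFlow e θ) (0, x) (1, 0)) 0 := by
    have hdiff := (contDiffAt_chartFlow hθ h0 he hx).differentiableAt (by simp)
    exact hdiff.hasFDerivAt.comp_hasDerivAt (0 : ℝ)
      ((hasDerivAt_id (0 : ℝ)).prodMk (hasDerivAt_const 0 x))
  have horbit : MDifferentiableAt 𝓘(ℝ, ℝ) 𝓘(ℝ, E) (fun s => θ s (e.symm x)) 0 :=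
    (contMDiff_flow_apply hθ _ 0).mdifferentiableAt (by simp)
  have hchart : MDifferentiableAt 𝓘(ℝ, E) 𝓘(ℝ, E) e (θ 0 (e.symm x)) := by
    rw [h0]
    exact mdifferentiableAt_atlas he (e.map_target hx)
  have hbase : (mfderiv 𝓘(ℝ, E) 𝓘(ℝ, E) e (θ 0 (e.symm x)) : E →L[ℝ] E) =
      mfderiv 𝓘(ℝ, E) 𝓘(ℝ, E) e (e.symm x) :=
    congrArg (β := E →L[ℝ] E) (fun p : M => mfderiv 𝓘(ℝ, E) 𝓘(ℝ, E) e p) (h0 _)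
  have hcomp := mfderiv_eq_fderiv.symm.trans (mfderiv_comp (0 : ℝ) hchart horbit)
  have hvelocity : chartField e Y x =
      (mfderiv 𝓘(ℝ, E) 𝓘(ℝ, E) e (θ 0 (e.symm x)) : E →L[ℝ] E)
        ((mfderiv 𝓘(ℝ, ℝ) 𝓘(ℝ, E) (fun s => θ s (e.symm x)) 0 : ℝ →L[ℝ] E) 1) := by
    rw [hbase]
    exact congrArg (mfderiv 𝓘(ℝ, E) 𝓘(ℝ, E) e (e.symm x) : E →L[ℝ] E) (hY _)
  exact hvelocity.trans ((DFunLike.congr_fun hcomp 1).symm.trans hline.deriv)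

lemma eventually_chartForm_pullback {Ω : TwoForm E M}
    (hinv : ∀ s p u v, Ω (θ s p) ((mfderiv 𝓘(ℝ, E) 𝓘(ℝ, E) (θ s) p : E →L[ℝ] E) u)
      ((mfderiv 𝓘(ℝ, E) 𝓘(ℝ, E) (θ s) p : E →L[ℝ] E) v) = Ω p u v) (u v : E) :
    ∀ᶠ s in 𝓝 (0 : ℝ), chartForm e Ω (chartFlow e θ (s, x))
        (fderiv ℝ (fun y => chartFlow e θ (s, y)) x u)
        (fderiv ℝ (fun y => chartFlow e θ (s, y)) x v) = chartForm e Ω x u v := by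
  have hmem : ∀ᶠ s in 𝓝 (0 : ℝ), θ s (e.symm x) ∈ e.source :=
    (contMDiff_flow_apply hθ (e.symm x)).continuous.continuousAt.preimage_mem_nhds
      (e.open_source.mem_nhds (by simpa only [h0] using e.map_target hx))
  filter_upwards [hmem] with s hs
  have hvel (w : E) := DFunLike.congr_fun (mfderiv_chart_symm_comp_fderiv he he hx
    ((contMDiff_flow hθ s _).mdifferentiableAt (by simp)) hs) w
  have hsymm : e.symm (chartFlow e θ (s, x)) = θ s (e.symm x) := e.left_inv hs
  rw [chartForm, hsymm]
  exact (congrArg₂ (fun w w' : E => Ω (θ s (e.symm x)) w w') (hvel u) (hvel v)).trans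
    (hinv s (e.symm x) _ _)

end ChartFlow

lemma lieDeriv_eq_zero_of_flow_invariant {θ : ℝ → M → M}
    (hθ : ContMDiff (𝓘(ℝ, ℝ).prod 𝓘(ℝ, E)) 𝓘(ℝ, E) ∞ fun q : ℝ × M => θ q.1 q.2)
    (h0 : ∀ p, θ 0 p = p) {Y : VectorField E M}
    (hY : ∀ p, Y p = (mfderiv 𝓘(ℝ, ℝ) 𝓘(ℝ, E) (fun s => θ s p) 0 : ℝ →L[ℝ] E) 1)
    {Ω : TwoForm E M}
    (hΩ : ∀ p, DifferentiableAt ℝ (chartForm (chartAt E p) Ω) (chartAt E p p))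
    (hinv : ∀ s p u v, Ω (θ s p) ((mfderiv 𝓘(ℝ, E) 𝓘(ℝ, E) (θ s) p : E →L[ℝ] E) u)
      ((mfderiv 𝓘(ℝ, E) 𝓘(ℝ, E) (θ s) p : E →L[ℝ] E) v) = Ω p u v) :
    lieDeriv Y Ω = 0 := by
  ext p u v
  have he := chart_mem_atlas E p
  have hx := mem_chart_target E p
  have hfield : chartField (chartAt E p) Y =ᶠ[𝓝 (chartAt E p p)]
      fun y => fderiv ℝ (chartFlow (chartAt E p) θ) (0, y) (1, 0) := by
    filter_upwards [(chartAt E p).open_target.mem_nhds hx] with y hy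
      using chartField_eq_fderiv_chartFlow hθ h0 he hy hY
  have hzero : ∀ᶠ y in 𝓝 (chartAt E p p), chartFlow (chartAt E p) θ (0, y) = y := by
    filter_upwards [(chartAt E p).open_target.mem_nhds hx] with y hy
    rw [chartFlow, h0, (chartAt E p).right_inv hy]
  have hderiv := hasDerivAt_pullback
    ((contDiffAt_chartFlow hθ h0 he hx).of_le ENat.LEInfty.out)
    hzero (hΩ p) u v
  have hconst := eventually_chartForm_pullback hθ h0 he hx hinv u v
  rw [lieDeriv, lieFlat_congr hfield .rfl]
  exact hderiv.unique ((hasDerivAt_const (0 : ℝ) _).congr_of_eventuallyEq hconst)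

end Flow

section Torus

variable {E : Type*} [NormedAddCommGroup E] [NormedSpace ℂ E]
  {M : Type*} [TopologicalSpace M] [ChartedSpace E M] [IsManifold 𝓘(ℂ, E) ω M]
  {k : ℕ} [MulAction (Fin k → Circle) M]

lemma lieDeriv_eq_zero_of_isTorusInvariant (hT : IsHolomorphicTorusAction E M k)
    {Y : VectorField E M} (hY : InTorusLieAlgebra k Y) {Ω : TwoForm E M}
    (hΩ : ∀ p, DifferentiableAt ℝ (chartForm (chartAt E p) Ω) (chartAt E p p))
    (hinv : IsTorusInvariant k Ω) : lieDeriv Y Ω = 0 := by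
  obtain ⟨b, hb⟩ := hY
  have hline : ContMDiff (𝓘(ℝ, ℝ).prod 𝓘(ℝ, E)) (𝓘(ℝ, Fin k → ℝ).prod 𝓘(ℝ, E)) ∞
      fun q : ℝ × M => (q.1 • b, q.2) :=
    ((contDiff_id.smul contDiff_const).contMDiff.comp contMDiff_fst).prodMk contMDiff_snd
  refine lieDeriv_eq_zero_of_flow_invariant (θ := fun s p => torusExp (s • b) • p)
    (hT.smooth.comp hline) (fun p => ?_) hb hΩ fun s => hinv (torusExp (s • b))
  simp only [zero_smul]
  exact (congrArg (· • p) (funext fun _ => Circle.exp_zero)).trans (one_smul _ p)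

end Torus

/-! ### The soliton equation -/

section Soliton

variable {E : Type*} [NormedAddCommGroup E] [NormedSpace ℂ E] [FiniteDimensional ℂ E]
  {M : Type*} [TopologicalSpace M] [ChartedSpace E M]

/-- The form `ρ_Ω + ½ L_X Ω - Ω`, which vanishes when `Ω` solves the soliton equation. -/
noncomputable def solitonDefect (X : VectorField E M) (Ω : TwoForm E M) : TwoForm E M :=
  ricciForm Ω + (1 / 2 : ℝ) • lieDeriv X Ω - Ω

/-- The Monge–Ampère operator `f ↦ log ((Ω + i∂∂̄f)ⁿ / Ωⁿ) - ½ X · f + f` of the soliton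
equation. -/
noncomputable def mongeAmpere (X : VectorField E M) (Ω : TwoForm E M) (f : M → ℝ) : M → ℝ :=
  (fun p => Real.log (volumeRatio (Ω + ddbar f) Ω p)) - (1 / 2 : ℝ) • dirDeriv X f + f

variable [IsManifold 𝓘(ℂ, E) ω M] {X : VectorField E M} {Ω : TwoForm E M} {f : M → ℝ}

lemma mongeAmpere_sub_of_ddbar_eq_zero (X : VectorField E M) (Ω : TwoForm E M)
    (hf : IsSmooth E f) {h : M → ℝ} (hh : IsSmooth E h) (hdd : ddbar (E := E) h = 0) :
    mongeAmpere X Ω (f - h) = mongeAmpere X Ω f + (1 / 2 : ℝ) • dirDeriv X h - h := by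
  rw [mongeAmpere, mongeAmpere, ddbar_sub_of_ddbar_eq_zero hf hh hdd, dirDeriv_sub hf hh]
  module

section Nondegenerate

variable (hX : IsRealHolomorphic X) (hf : IsSmooth E f) (hΩ : IsNondegenerate Ω)
  (hΩf : IsNondegenerate (Ω + ddbar f))
include hX hf hΩ hΩf

lemma isSmooth_mongeAmpere : IsSmooth E (mongeAmpere X Ω f) :=
  ((isSmooth_log_volumeRatio hΩf hΩ).sub ((isSmooth_dirDeriv hX hf).const_smul _)).add hf

lemma ddbar_mongeAmpere :
    ddbar (mongeAmpere X Ω f) = solitonDefect X Ω - solitonDefect X (Ω + ddbar f) := by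
  have hlog := isSmooth_log_volumeRatio hΩf hΩ
  have hXf := isSmooth_dirDeriv hX hf
  rw [mongeAmpere, ddbar_add (hlog.sub (hXf.const_smul _)) hf, ddbar_sub hlog (hXf.const_smul _),
    ddbar_const_smul _ hXf, ddbar_log_volumeRatio hΩf hΩ, solitonDefect, solitonDefect,
    lieDeriv_add_ddbar hX hf hΩ.differentiableAt_chartForm]
  module

lemma dirDeriv_rotate_mongeAmpere (hinv : lieDeriv (rotate X) Ω = 0)
    (hJ : ∀ p, dirDeriv (rotate X) f p = 0) :
    ∀ p, dirDeriv (rotate X) (mongeAmpere X Ω f) p = 0 := by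
  intro p
  have hlog := isSmooth_log_volumeRatio hΩf hΩ
  have hXf := isSmooth_dirDeriv hX hf
  have hinvf : lieDeriv (rotate X) (Ω + ddbar f) = 0 := by
    rw [lieDeriv_add_ddbar hX.rotate hf hΩ.differentiableAt_chartForm, hinv,
      show dirDeriv (rotate X) f = fun _ => 0 from funext hJ, ddbar_const]
    module
  rw [mongeAmpere, dirDeriv_add (hlog.sub (hXf.const_smul _)) hf,
    dirDeriv_sub hlog (hXf.const_smul _), dirDeriv_const_smul _ hXf]
  simp only [Pi.add_apply, Pi.sub_apply, Pi.smul_apply,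
    dirDeriv_log_volumeRatio_eq_zero hΩf hΩ (congrFun hinvf p) (congrFun hinv p),
    dirDeriv_rotate_dirDeriv hX hf hJ, hJ, smul_zero, sub_zero, add_zero]

variable {F : M → ℝ} (hF : IsSmooth E F) (hdefect : solitonDefect X Ω = ddbar F)
include hF hdefect

lemma solitonDefect_add_ddbar_eq_zero {a : ℝ} (hMA : mongeAmpere X Ω f = F + fun _ => a) :
    solitonDefect X (Ω + ddbar f) = 0 := by
  calc solitonDefect X (Ω + ddbar f) = ddbar F - ddbar (mongeAmpere X Ω f) := by
        rw [ddbar_mongeAmpere hX hf hΩ hΩf, hdefect]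
        module
    _ = 0 := by
        rw [hMA, ddbar_add hF (isSmooth_const a), ddbar_const]
        module

lemma exists_mongeAmpere_eq_add_const [PreconnectedSpace M] (hinv : lieDeriv (rotate X) Ω = 0)
    (hJf : ∀ p, dirDeriv (rotate X) f p = 0) (hJF : ∀ p, dirDeriv (rotate X) F p = 0)
    (hsol : solitonDefect X (Ω + ddbar f) = 0) (a : ℝ) :
    ∃ φ, IsSmooth E φ ∧ (∀ p, dirDeriv (rotate X) φ p = 0) ∧ ddbar (E := E) φ = ddbar f ∧
      mongeAmpere X Ω φ = F + fun _ => a := by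
  have hMA := isSmooth_mongeAmpere hX hf hΩ hΩf
  have hJMA := dirDeriv_rotate_mongeAmpere hX hf hΩ hΩf hinv hJf
  set G := mongeAmpere X Ω f - F with hGdef
  have hG : IsSmooth E G := hMA.sub hF
  have hJG : ∀ p, dirDeriv (rotate X) G p = 0 := fun p => by
    rw [hGdef, dirDeriv_sub hMA hF, Pi.sub_apply, hJMA, hJF, sub_zero]
  have hddG : ddbar (E := E) G = 0 := by
    rw [hGdef, ddbar_sub hMA hF, ddbar_mongeAmpere hX hf hΩ hΩf, hsol, hdefect]
    module
  obtain ⟨c, hc⟩ := exists_dirDeriv_eq_const hX hG hJG hddG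
  have hconst := isSmooth_const (E := E) (M := M) (a - c / 2)
  -- Subtracting `h` changes `MA(f) = F + G` by `½ X · h - h = c / 2 - h`.
  set h : M → ℝ := G - fun _ => a - c / 2 with hhdef
  have hh : IsSmooth E h := hG.sub hconst
  have hddh : ddbar (E := E) h = 0 :=
    (ddbar_sub_of_ddbar_eq_zero hG hconst (ddbar_const _)).trans hddG
  have hdir (Y : VectorField E M) : dirDeriv Y h = dirDeriv Y G := by
    rw [hhdef, dirDeriv_sub hG hconst, dirDeriv_const, sub_zero]
  refine ⟨f - h, hf.sub hh, fun p => ?_, ddbar_sub_of_ddbar_eq_zero hf hh hddh, ?_⟩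
  · rw [dirDeriv_sub hf hh, hdir, Pi.sub_apply, hJf, hJG, sub_zero]
  · rw [mongeAmpere_sub_of_ddbar_eq_zero X Ω hf hh hddh, hdir, hc]
    ext p
    simp only [hhdef, hGdef, Pi.add_apply, Pi.sub_apply, Pi.smul_apply, Function.const_apply,
      smul_eq_mul]
    ring

end Nondegenerate

end Soliton

end KRSoliton

open KRSoliton in
theorem proposition4p1_general
    {E : Type*} [NormedAddCommGroup E] [NormedSpace ℂ E] [FiniteDimensional ℂ E]
    {M : Type*} [TopologicalSpace M] [PreconnectedSpace M]
    [ChartedSpace E M] [IsManifold 𝓘(ℂ, E) ω M]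
    {X : VectorField E M} (hX : IsRealHolomorphic X)
    {Ω : TwoForm E M} (hΩ : IsHermitianForm Ω) (hinv : lieDeriv (rotate X) Ω = 0)
    (hpotential : ∃ F₁ : M → ℝ, IsSmooth E F₁ ∧ HasCompactSupport F₁ ∧
      (∀ p, dirDeriv (rotate X) F₁ p = 0) ∧
      ricciForm Ω + (1 / 2 : ℝ) • lieDeriv X Ω - Ω = ddbar F₁) :
    (∃ φ' : M → ℝ, IsSmooth E φ' ∧ (∀ p, dirDeriv (rotate X) φ' p = 0) ∧
        IsPositive (Ω + ddbar φ') ∧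
        ricciForm (Ω + ddbar φ') + (1 / 2 : ℝ) • lieDeriv X (Ω + ddbar φ') = Ω + ddbar φ') ↔
      ∀ a : ℝ, ∃ φ F₂ : M → ℝ,
        IsSmooth E φ ∧ (∀ p, dirDeriv (rotate X) φ p = 0) ∧ IsPositive (Ω + ddbar φ) ∧
        IsSmooth E F₂ ∧ HasCompactSupport F₂ ∧ (∀ p, dirDeriv (rotate X) F₂ p = 0) ∧
        ricciForm Ω + (1 / 2 : ℝ) • lieDeriv X Ω - Ω = ddbar F₂ ∧
        ∀ p, Real.log (volumeRatio (Ω + ddbar φ) Ω p) - (1 / 2) * dirDeriv X φ p + φ p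
          = F₂ p + a := by
  have hnd := hΩ.isNondegenerate
  have hnd_add {f : M → ℝ} (hf : IsSmooth E f) (hpos : IsPositive (Ω + ddbar f)) :=
    (hΩ.add_ddbar hf hpos).isNondegenerate
  constructor
  · rintro ⟨f, hf, hJf, hpos, hsol⟩ a
    obtain ⟨F, hF, hFc, hJF, hdefect⟩ := hpotential
    obtain ⟨φ, hφ, hJφ, hddφ, hMA⟩ := exists_mongeAmpere_eq_add_const hX hf hnd (hnd_add hf hpos)
      hF hdefect hinv hJf hJF (sub_eq_zero.2 hsol) a
    exact ⟨φ, F, hφ, hJφ, hddφ ▸ hpos, hF, hFc, hJF, hdefect, congrFun hMA⟩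
  · intro h
    obtain ⟨φ, F, hφ, hJφ, hpos, hF, -, -, hdefect, hMA⟩ := h 0
    exact ⟨φ, hφ, hJφ, hpos, sub_eq_zero.1 <| solitonDefect_add_ddbar_eq_zero hX hφ hnd
      (hnd_add hφ hpos) hF hdefect (funext hMA)⟩

open KRSoliton in
theorem proposition4p1
    -- the complex manifold `M` with its torus action and the vector field `X`
    {E : Type*} [NormedAddCommGroup E] [NormedSpace ℂ E] [FiniteDimensional ℂ E]
    {M : Type*} [TopologicalSpace M] [T2Space M] [SecondCountableTopology M] [ConnectedSpace M]
    [ChartedSpace E M] [IsManifold 𝓘(ℂ, E) ω M]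
    (k : ℕ) [MulAction (Fin k → Circle) M] (hT : IsHolomorphicTorusAction E M k)
    (X : VectorField E M) (hX : IsRealHolomorphic X) (hJX : InTorusLieAlgebra k (rotate X))
    -- the compact Kähler-Einstein Fano manifold `D`
    {F : Type*} [NormedAddCommGroup F] [NormedSpace ℂ F] [FiniteDimensional ℂ F]
    {D : Type*} [TopologicalSpace D] [T2Space D] [SecondCountableTopology D] [ConnectedSpace D]
    [CompactSpace D] [ChartedSpace F D] [IsManifold 𝓘(ℂ, F) ω D]
    (ΩD : TwoForm F D) (hD : IsKahlerForm ΩD) (hDE : ricciForm ΩD = ΩD)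
    -- the background metric
    (Ω : TwoForm E M) (lam : ℝ) (K : Set M) (Khat : Set (ℂ × D))
    (ν : OpenPartialHomeomorph M (ℂ × D))
    (hΩ : IsBackgroundMetric k X Ω ΩD lam K Khat ν) :
    (∃ φ' : M → ℝ, IsSmooth E φ' ∧ (∀ p, dirDeriv (rotate X) φ' p = 0) ∧
        IsPositive (Ω + ddbar φ') ∧
        ricciForm (Ω + ddbar φ') + (1 / 2 : ℝ) • lieDeriv X (Ω + ddbar φ') = Ω + ddbar φ') ↔
      ∀ a : ℝ, ∃ φ F₂ : M → ℝ,
        IsSmooth E φ ∧ (∀ p, dirDeriv (rotate X) φ p = 0) ∧ IsPositive (Ω + ddbar φ) ∧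
        IsSmooth E F₂ ∧ HasCompactSupport F₂ ∧ (∀ p, dirDeriv (rotate X) F₂ p = 0) ∧
        ricciForm Ω + (1 / 2 : ℝ) • lieDeriv X Ω - Ω = ddbar F₂ ∧
        ∀ p, Real.log (volumeRatio (Ω + ddbar φ) Ω p) - (1 / 2) * dirDeriv X φ p + φ p
          = F₂ p + a := by
  have hK := hΩ.kahler.isHermitianForm
  exact proposition4p1_general hX hK (lieDeriv_eq_zero_of_isTorusInvariant hT hJX
    hK.isNondegenerate.differentiableAt_chartForm hΩ.torusInvariant) hΩ.ricci_potential
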